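/- All graphs are simple, undirected, nonempty and connected, but not necessarily finite or locally finite; let $G$ be such a graph with path metric $d$. A family of sets has the \emph{(finite) Helly property} if every (finite) subfamily of pairwise intersecting sets has a nonempty intersection. $G$ is \emph{(finitely) Helly} if the family of its balls $B_r(v)=\{x : d(v,x)\le r\}$ has the (finite) Helly property, \emph{$1$-Helly} if the family of its balls of radius $1$ has the Helly property, and \emph{(finitely) clique-Helly} if the family of its (finite or infinite) maximal cliques has the (finite) Helly property. $G$ is \emph{weakly modular} if for every vertex $u$: (TC) for all $v,w$ with $1=d(v,w)<d(u,v)=d(u,w)$ there is a common neighbour $x$ of $v,w$ with $d(u,x)=d(u,v)-1$; and (QC) for all $v,w,z$ with $d(v,z)=d(w,z)=1$ and $2=d(v,w)\le d(u,v)=d(u,w)=d(u,z)-1$ there is a common neighbour $x$ of $v,w$ with $d(u,x)=d(u,v)-1$. $G$ is \emph{dismantlable} if its vertices admit a well-order $\prec$ such that every vertex $v$ other than the least one has a neighbour $w\prec v$ such that, in the subgraph induced by $\{u : u\preceq v\}$, the unit ball around $w$ contains the unit ball around $v$. The \emph{clique complex} $X(G)$ is the simplicial complex whose simplices are the nonempty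 finite cliques of $G$, and the \emph{triangle complex} $X^{\triangle}(G)$ is its $2$-skeleton; their topological properties are those of the geometric realization with the weak (CW) topology. A \emph{covering} of a simplicial complex $X$ is a surjective simplicial map $p\colon\widetilde X\to X$ that maps the star of every vertex $w$ isomorphically onto the star of $p(w)$; it is a \emph{universal cover} if $\widetilde X$ is simply connected. \textbf{Theorem.} (1) The following are equivalent: (i) $G$ is Helly; (ii) $G$ is $1$-Helly and weakly modular; (iii) $G$ is clique-Helly and dismantlable; (iv) $G$ is clique-Helly and $X(G)$ is simply connected. If $X(G)$ is finite-dimensional, they are also equivalent to (v) $G$ is clique-Helly and $X(G)$ is contractible. (2) If $G$ is clique-Helly (respectively, finitely clique-Helly), then the $1$-skeleton of the universal cover of $X^{\triangle}(G)$ is Helly (respectively, finitely Helly). Moreover, $G$ is Helly if and only if $G$ is clique-Helly and $X^{\triangle}(G)$ is simply connected. (3) If $G$ is finitely Helly, then $X^{\triangle}(G)$ and $X(G)$ are simply connected. If $G$ is finitely clique-Helly and $X^{\triangle}(G)$ or $X(G)$ is simply connected, then $G$ is finitely Helly. If $G$ has no infinite clique, then $G$ is finitely Helly if and only if $G$ is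 finitely clique-Helly and $X^{\triangle}(G)$ (equivalently, $X(G)$) is simply connected. -/

import Mathlib

/-- The collection of sets `F` has the Helly property: every subcollection of pairwise
intersecting sets has a nonempty intersection. -/
def HellyProperty {α : Type*} (F : Set (Set α)) : Prop :=
  ∀ S : Set (Set α), S ⊆ F → (∀ A ∈ S, ∀ B ∈ S, (A ∩ B).Nonempty) → (⋂₀ S).Nonempty

/-- The finite Helly property: the same for finite subcollections. -/
def FiniteHellyProperty {α : Type*} (F : Set (Set α)) : Prop :=
  ∀ S : Set (Set α), S ⊆ F → S.Finite →
    (∀ A ∈ S, ∀ B ∈ S, (A ∩ B).Nonempty) → (⋂₀ S).Nonempty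

namespace SimpleGraph

/-- The ball of radius `r` around `v`; the distance between vertices of different components is
infinite. -/
def hball {V : Type*} (G : SimpleGraph V) (v : V) (r : ℕ) : Set V :=
  {x | G.edist v x ≤ (r : ℕ∞)}

/-- The collection of all balls. -/
def ballFamily {V : Type*} (G : SimpleGraph V) : Set (Set V) :=
  {B | ∃ (v : V) (r : ℕ), B = G.hball v r}

/-- The collection of all unit balls. -/
def unitBallFamily {V : Type*} (G : SimpleGraph V) : Set (Set V) :=
  {B | ∃ v : V, B = G.hball v 1}

/-- The collection of all (finite or infinite) inclusion-maximal cliques. -/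
def maximalCliqueFamily {V : Type*} (G : SimpleGraph V) : Set (Set V) :=
  {K | Maximal G.IsClique K}

/-- Helly graphs. -/
def IsHelly {V : Type*} (G : SimpleGraph V) : Prop :=
  HellyProperty G.ballFamily

/-- Finitely Helly graphs. -/
def IsFinitelyHelly {V : Type*} (G : SimpleGraph V) : Prop :=
  FiniteHellyProperty G.ballFamily

/-- `1`-Helly graphs. -/
def IsOneHelly {V : Type*} (G : SimpleGraph V) : Prop :=
  HellyProperty G.unitBallFamily

/-- Clique-Helly graphs. -/
def IsCliqueHelly {V : Type*} (G : SimpleGraph V) : Prop :=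
  HellyProperty G.maximalCliqueFamily

/-- Finitely clique-Helly graphs. -/
def IsFinitelyCliqueHelly {V : Type*} (G : SimpleGraph V) : Prop :=
  FiniteHellyProperty G.maximalCliqueFamily

/-- The triangle condition with respect to the vertex `u`. -/
def TriangleCondition {V : Type*} (G : SimpleGraph V) (u : V) : Prop :=
  ∀ v w : V, G.dist v w = 1 → 1 < G.dist u v → G.dist u v = G.dist u w →
    ∃ x : V, G.Adj x v ∧ G.Adj x w ∧ G.dist u x + 1 = G.dist u v

/-- The quadrangle condition with respect to the vertex `u`. -/
def QuadrangleCondition {V : Type*} (G : SimpleGraph V) (u : V) : Prop :=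
  ∀ v w z : V, G.dist v z = 1 → G.dist w z = 1 → G.dist v w = 2 → 2 ≤ G.dist u v →
    G.dist u v = G.dist u w → G.dist u w + 1 = G.dist u z →
    ∃ x : V, G.Adj x v ∧ G.Adj x w ∧ G.dist u x + 1 = G.dist u v

/-- Weakly modular graphs. -/
def IsWeaklyModular {V : Type*} (G : SimpleGraph V) : Prop :=
  ∀ u : V, G.TriangleCondition u ∧ G.QuadrangleCondition u

/-- Dismantlable graphs: there is a well-order `r` of the vertices such that every vertex `v`
other than the least one has a neighbour `w` preceding `v` which dominates `v` in the subgraph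
induced by the vertices up to and including `v`. -/
def IsDismantlable {V : Type*} (G : SimpleGraph V) : Prop :=
  ∃ r : V → V → Prop, IsWellOrder V r ∧
    ∀ v : V, (∃ u, r u v) →
      ∃ w : V, r w v ∧ G.Adj v w ∧
        ∀ x : V, (x = v ∨ r x v) → (x = v ∨ G.Adj v x) → (x = w ∨ G.Adj w x)

/-- The clique complex: its simplices are the nonempty finite cliques. -/
def cliqueComplex {V : Type*} (G : SimpleGraph V) : AbstractSimplicialComplex V where
  faces := {s | s.Nonempty ∧ G.IsClique (s : Set V)}
  isRelLowerSet_faces := fun _ hs =>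
    ⟨hs.1, fun _ hts ht => ⟨ht, hs.2.subset (Finset.coe_subset.mpr hts)⟩⟩
  singleton_mem := fun v => ⟨Finset.singleton_nonempty v, by simp⟩

/-- The triangle complex: its simplices are the vertices, the edges and the triangles. -/
def triangleComplex {V : Type*} (G : SimpleGraph V) : AbstractSimplicialComplex V where
  faces := {s | s.Nonempty ∧ G.IsClique (s : Set V) ∧ s.card ≤ 3}
  isRelLowerSet_faces := fun _ hs =>
    ⟨hs.1, fun _ hts ht => ⟨ht, hs.2.1.subset (Finset.coe_subset.mpr hts),
      (Finset.card_le_card hts).trans hs.2.2⟩⟩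
  singleton_mem := fun v => ⟨Finset.singleton_nonempty v, by simp, by simp⟩

end SimpleGraph

namespace AbstractSimplicialComplex

/-- The points of the geometric realization of `K`, in barycentric coordinates. -/
def Realization {V : Type*} (K : AbstractSimplicialComplex V) : Type _ :=
  {x : V →₀ ℝ // (∀ v, 0 ≤ x v) ∧ x.support ∈ K.faces ∧ (x.sum fun _ a => a) = 1}

/-- The closed simplex of the geometric realization spanned by `s`. -/
def ClosedSimplex {V : Type*} (K : AbstractSimplicialComplex V) (s : Finset V) : Type _ :=
  {x : K.Realization // x.1.support ⊆ s}

/-- The inclusion of a closed simplex into the geometric realization. -/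
def ClosedSimplex.incl {V : Type*} {K : AbstractSimplicialComplex V} {s : Finset V}
    (x : K.ClosedSimplex s) : K.Realization :=
  x.1

/-- A closed simplex has the Euclidean topology, given by the barycentric coordinates. -/
instance instTopologicalSpaceClosedSimplex {V : Type*} (K : AbstractSimplicialComplex V)
    (s : Finset V) : TopologicalSpace (K.ClosedSimplex s) :=
  TopologicalSpace.induced (fun (x : K.ClosedSimplex s) (v : V) => x.incl.1 v)
    Pi.topologicalSpace

/-- The weak (CW) topology: the finest topology for which the inclusions of all closed simplices
are continuous. -/
instance instTopologicalSpaceRealization {V : Type*} (K : AbstractSimplicialComplex V) :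
    TopologicalSpace K.Realization :=
  ⨆ s : K.faces, TopologicalSpace.coinduced
    (ClosedSimplex.incl : K.ClosedSimplex s.1 → K.Realization) inferInstance

/-- The dimensions of the simplices are bounded. -/
def IsFiniteDimensional {V : Type*} (K : AbstractSimplicialComplex V) : Prop :=
  ∃ n : ℕ, ∀ s ∈ K.faces, s.card ≤ n + 1

open Classical in
/-- The `1`-skeleton. -/
def oneSkeleton {V : Type*} (K : AbstractSimplicialComplex V) : SimpleGraph V where
  Adj a b := a ≠ b ∧ ({a, b} : Finset V) ∈ K.faces
  symm := ⟨fun _ _ h => ⟨h.1.symm, by simpa only [Finset.pair_comm] using h.2⟩⟩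
  loopless := ⟨fun _ h => h.1 rfl⟩

open Classical in
/-- The simplices of the star of the vertex `v`, that is, of the subcomplex spanned by
the simplices containing `v`. -/
def vertexStar {V : Type*} (K : AbstractSimplicialComplex V) (v : V) : Set (Finset V) :=
  {s | s ∈ K.faces ∧ insert v s ∈ K.faces}

open Classical in
/-- Covering maps of simplicial complexes: surjective simplicial maps that restrict to an
isomorphism from the star of each vertex `w` onto the star of its image. (As singletons are
simplices, a bijection induced by `p` between the simplices of the stars is one between their
vertices, and so it preserves dimensions and inclusions in both directions.) -/
structure IsCovering {W V : Type*} (L : AbstractSimplicialComplex W)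
    (K : AbstractSimplicialComplex V) (p : W → V) : Prop where
  simplicial : ∀ s ∈ L.faces, s.image p ∈ K.faces
  surjective : ∀ t ∈ K.faces, ∃ s ∈ L.faces, s.image p = t
  bijOn_star : ∀ w : W, Set.BijOn (fun s : Finset W => s.image p) (L.vertexStar w) (K.vertexStar (p w))

/-- `L`, with the map `p`, is a universal cover of `K`: a simply connected covering complex. -/
structure IsUniversalCover {W V : Type*} (L : AbstractSimplicialComplex W)
    (K : AbstractSimplicialComplex V) (p : W → V) : Prop where
  isCovering : L.IsCovering K p
  simplyConnected : SimplyConnectedSpace L.Realization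

end AbstractSimplicialComplex

/-! The passage from local to global rests on domination towards a base vertex `u`.
`FinitelyDominated` says that finitely many vertices of the unit ball around `v`, all within `k + 1`
of `u`, can be replaced at once by a vertex within `k` of `u` that is near `v` and all of them;
`BallDominated` does this for the whole set. Helly balls give domination, since the ball of radius
`k` around `u` and the unit balls in question pairwise meet. Conversely, domination for every `u`
gives the finite Helly property (`isFinitelyHelly_of_finitelyDominated`): a common point of all
balls but one, chosen closest to the remaining centre, can otherwise be moved closer.

Simple connectedness enters through sheets, which are candidates for balls around a lift of `u` in
the universal cover. The next sheet attaches to each point the vertices near its projection and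
identifies extensions of adjacent points by the same vertex. Finite clique-Hellyness guarantees that
a point with finitely many neighbours always lies in a copy of a unit ball of `G`
(`Dominated.next`). The union of the sheets carries a transport along edges that is trivial around
triangles, so if all group-valued cocycles are coboundaries, it projects injectively to `G`. The
sheets are then balls of `G`, and their local structure is `FinitelyDominated`.

For a complex whose 2-skeleton is given by `G`, simple connectedness yields trivial cocycles because
a cocycle defines a covering (`HasTwoSkeleton.cocyclesTrivial`); the converse is a van Kampen
argument with open stars (`HasTwoSkeleton.simplyConnectedSpace`). Cocycles also vanish along an
elimination order (`cocyclesTrivial_of_rank`), which covers dismantlable and finitely Helly graphs.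

For infinite families, finite Hellyness and clique-Hellyness together give the Helly property for
unit balls (`IsFinitelyHelly.isOneHelly`), and ball domination extends it to all balls
(`IsOneHelly.isHelly`). Weak modularity with the unit-ball property yields ball domination. Iterated
domination also contracts the clique complex, and coverings inherit clique-Hellyness, so the same
criterion applies to the universal cover. -/

namespace SimpleGraph

/-! ### Nearness, balls and cliques in terms of the path metric -/

variable {V : Type*} {G : SimpleGraph V}

/-- Two vertices are near if they are equal or adjacent. -/
def Near (G : SimpleGraph V) (a b : V) : Prop := a = b ∨ G.Adj a b

@[refl] lemma Near.refl (a : V) : G.Near a a := Or.inl rfl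

lemma Near.rfl {a : V} : G.Near a a := Or.inl (Eq.refl a)

@[symm] lemma Near.symm {a b : V} (h : G.Near a b) : G.Near b a :=
  h.elim (fun h => Or.inl h.symm) (fun h => Or.inr h.symm)

lemma Adj.near {a b : V} (h : G.Adj a b) : G.Near a b := Or.inr h

lemma Near.adj {a b : V} (h : G.Near a b) (hab : a ≠ b) : G.Adj a b := h.resolve_left hab

lemma Near.dist_le {a b : V} (h : G.Near a b) : G.dist a b ≤ 1 := by
  rcases h with rfl | h
  · simp
  · exact (SimpleGraph.dist_eq_one_iff_adj.mpr h).le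

lemma Connected.near_iff (hG : G.Connected) {a b : V} : G.Near a b ↔ G.dist a b ≤ 1 := by
  refine ⟨Near.dist_le, fun h => ?_⟩
  rcases Nat.le_one_iff_eq_zero_or_eq_one.mp h with h | h
  · exact Or.inl ((hG.dist_eq_zero_iff).mp h)
  · exact Or.inr (SimpleGraph.dist_eq_one_iff_adj.mp h)

lemma Connected.dist_le_of_near (hG : G.Connected) {u a b : V} {r : ℕ} (h : G.dist u a ≤ r)
    (hab : G.Near a b) : G.dist u b ≤ r + 1 :=
  hG.dist_triangle.trans (add_le_add h hab.dist_le)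

lemma Connected.dist_le_of_near' (hG : G.Connected) {u a b : V} {r : ℕ} (h : G.dist a u ≤ r)
    (hab : G.Near a b) : G.dist b u ≤ r + 1 := by
  rw [dist_comm] at h ⊢
  exact hG.dist_le_of_near h hab

lemma Connected.mem_hball (hG : G.Connected) {v x : V} {r : ℕ} :
    x ∈ G.hball v r ↔ G.dist v x ≤ r := by
  have h : (G.dist v x : ℕ∞) = G.edist v x := (hG v x).coe_dist_eq_edist
  simp only [hball, Set.mem_ofPred_eq, ← h, Nat.cast_le]

lemma Connected.exists_dist_split (hG : G.Connected) {u v : V} {r s : ℕ}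
    (h : G.dist u v ≤ r + s) : ∃ x, G.dist u x ≤ r ∧ G.dist x v ≤ s := by
  obtain ⟨p, hp⟩ := hG.exists_walk_length_eq_dist u v
  refine ⟨p.getVert r, (SimpleGraph.dist_le (p.take r)).trans ?_,
    (SimpleGraph.dist_le (p.drop r)).trans ?_⟩
  · rw [Walk.take_length]; exact min_le_left _ _
  · rw [Walk.drop_length]; omega

lemma Connected.exists_near_dist (hG : G.Connected) {u v : V} {r : ℕ}
    (h : G.dist u v ≤ r + 1) : ∃ x, G.Near u x ∧ G.dist x v ≤ r := by
  rw [add_comm] at h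
  obtain ⟨x, h1, h2⟩ := hG.exists_dist_split h
  exact ⟨x, hG.near_iff.mpr h1, h2⟩

lemma Connected.hball_inter_nonempty (hG : G.Connected) {u v : V} {r s : ℕ} :
    (G.hball u r ∩ G.hball v s).Nonempty ↔ G.dist u v ≤ r + s := by
  constructor
  · rintro ⟨x, h1, h2⟩
    rw [hG.mem_hball] at h1 h2
    rw [dist_comm] at h2
    exact hG.dist_triangle.trans (add_le_add h1 h2)
  · intro h
    obtain ⟨x, h1, h2⟩ := hG.exists_dist_split h
    refine ⟨x, hG.mem_hball.mpr h1, hG.mem_hball.mpr ?_⟩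
    rwa [dist_comm]

lemma Connected.isHelly_iff (hG : G.Connected) : G.IsHelly ↔
    ∀ S : Set (V × ℕ), (∀ a ∈ S, ∀ b ∈ S, G.dist a.1 b.1 ≤ a.2 + b.2) →
      ∃ x, ∀ a ∈ S, G.dist a.1 x ≤ a.2 := by
  constructor
  · intro h S hS
    obtain ⟨x, hx⟩ := h ((fun a : V × ℕ => G.hball a.1 a.2) '' S)
      (by rintro _ ⟨a, -, rfl⟩; exact ⟨_, _, rfl⟩)
      (by
        rintro _ ⟨a, ha, rfl⟩ _ ⟨b, hb, rfl⟩
        exact hG.hball_inter_nonempty.mpr (hS a ha b hb))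
    exact ⟨x, fun a ha => hG.mem_hball.mp (hx _ ⟨a, ha, rfl⟩)⟩
  · intro h S hS hS'
    obtain ⟨x, hx⟩ := h {a | G.hball a.1 a.2 ∈ S}
      (fun a ha b hb => hG.hball_inter_nonempty.mp (hS' _ ha _ hb))
    refine ⟨x, fun A hA => ?_⟩
    obtain ⟨v, r, rfl⟩ := hS hA
    exact hG.mem_hball.mpr (hx (v, r) hA)

lemma Connected.isFinitelyHelly_iff (hG : G.Connected) : G.IsFinitelyHelly ↔
    ∀ S : Set (V × ℕ), S.Finite → (∀ a ∈ S, ∀ b ∈ S, G.dist a.1 b.1 ≤ a.2 + b.2) →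
      ∃ x, ∀ a ∈ S, G.dist a.1 x ≤ a.2 := by
  constructor
  · intro h S hf hS
    obtain ⟨x, hx⟩ := h ((fun a : V × ℕ => G.hball a.1 a.2) '' S)
      (by rintro _ ⟨a, -, rfl⟩; exact ⟨_, _, rfl⟩) (hf.image _)
      (by
        rintro _ ⟨a, ha, rfl⟩ _ ⟨b, hb, rfl⟩
        exact hG.hball_inter_nonempty.mpr (hS a ha b hb))
    exact ⟨x, fun a ha => hG.mem_hball.mp (hx _ ⟨a, ha, rfl⟩)⟩
  · intro h S hS hf hS'
    have := hG.nonempty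
    have hS1 : ∀ A ∈ S, ∃ (v : V) (r : ℕ), A = G.hball v r := fun A hA => hS hA
    -- A set may be a ball for infinitely many centres and radii; one chosen pair per ball keeps the
    -- index set finite.
    choose! v r hvr using hS1
    obtain ⟨x, hx⟩ := h ((fun A => (v A, r A)) '' S) (hf.image _) (by
      rintro _ ⟨A, hA, rfl⟩ _ ⟨B, hB, rfl⟩
      have := hS' A hA B hB
      rw [hvr A hA, hvr B hB] at this
      exact hG.hball_inter_nonempty.mp this)
    refine ⟨x, fun A hA => ?_⟩
    rw [hvr A hA]
    exact hG.mem_hball.mpr (hx _ ⟨A, hA, rfl⟩)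

lemma Connected.isOneHelly_iff (hG : G.Connected) : G.IsOneHelly ↔
    ∀ S : Set V, (∀ a ∈ S, ∀ b ∈ S, G.dist a b ≤ 2) → ∃ x, ∀ a ∈ S, G.Near a x := by
  constructor
  · intro h S hS
    obtain ⟨x, hx⟩ := h ((fun a : V => G.hball a 1) '' S)
      (by rintro _ ⟨a, -, rfl⟩; exact ⟨_, rfl⟩)
      (by
        rintro _ ⟨a, ha, rfl⟩ _ ⟨b, hb, rfl⟩
        exact hG.hball_inter_nonempty.mpr (hS a ha b hb))
    exact ⟨x, fun a ha => hG.near_iff.mpr (hG.mem_hball.mp (hx _ ⟨a, ha, rfl⟩))⟩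
  · intro h S hS hS'
    obtain ⟨x, hx⟩ := h {a | G.hball a 1 ∈ S}
      (fun a ha b hb => hG.hball_inter_nonempty.mp (hS' _ ha _ hb))
    refine ⟨x, fun A hA => ?_⟩
    obtain ⟨v, rfl⟩ := hS hA
    exact hG.mem_hball.mpr (hG.near_iff.mp (hx v hA))

lemma isClique_iff_near {s : Set V} : G.IsClique s ↔ ∀ a ∈ s, ∀ b ∈ s, G.Near a b := by
  constructor
  · intro h a ha b hb
    by_cases hab : a = b
    · exact Or.inl hab
    · exact Or.inr (h ha hb hab)
  · intro h a ha b hb hab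
    exact (h a ha b hb).adj hab

lemma exists_maximal_clique {s : Set V} (hs : G.IsClique s) :
    ∃ K, Maximal G.IsClique K ∧ s ⊆ K := by
  obtain ⟨K, hsK, hK⟩ := zorn_subset_nonempty {s | G.IsClique s} (fun c hc hch hne => by
    refine ⟨⋃₀ c, ?_, fun s hs => Set.subset_sUnion_of_mem hs⟩
    refine isClique_iff_near.mpr ?_
    rintro a ⟨s, hs, has⟩ b ⟨t, ht, hbt⟩
    rcases hch.total hs ht with h | h
    · exact isClique_iff_near.mp (hc ht) a (h has) b hbt
    · exact isClique_iff_near.mp (hc hs) a has b (h hbt)) s hs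
  exact ⟨K, hK, hsK⟩

lemma mem_of_maximal_clique {K : Set V} (hK : Maximal G.IsClique K) {x : V}
    (hx : ∀ y ∈ K, G.Near x y) : x ∈ K := by
  have h : G.IsClique (insert x K) := by
    refine isClique_iff_near.mpr ?_
    rintro a (rfl | ha) b (rfl | hb)
    · rfl
    · exact hx b hb
    · exact (hx a ha).symm
    · exact isClique_iff_near.mp hK.1 a ha b hb
  exact hK.2 h (Set.subset_insert x K) (Set.mem_insert x K)

/-- Enlarging the cliques to maximal ones only enlarges their intersections, and a common vertex of
the maximal cliques is near everything in the given ones. In this form clique-Hellyness applies to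
cliques that need not be maximal. -/
lemma IsCliqueHelly.exists_near (h : G.IsCliqueHelly) (S : Set (Set V))
    (hS : ∀ C ∈ S, G.IsClique C) (hS' : ∀ A ∈ S, ∀ B ∈ S, (A ∩ B).Nonempty) :
    ∃ x, ∀ C ∈ S, ∀ y ∈ C, G.Near x y := by
  choose! K hK hCK using fun C hC => exists_maximal_clique (hS C hC)
  obtain ⟨x, hx⟩ := h (K '' S) (by rintro _ ⟨C, hC, rfl⟩; exact hK C hC) (by
    rintro _ ⟨A, hA, rfl⟩ _ ⟨B, hB, rfl⟩
    exact (hS' A hA B hB).mono (Set.inter_subset_inter (hCK A hA) (hCK B hB)))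
  exact ⟨x, fun C hC y hy => isClique_iff_near.mp (hK C hC).1 x (hx _ ⟨C, hC, rfl⟩) y (hCK C hC hy)⟩

lemma IsFinitelyCliqueHelly.exists_near (h : G.IsFinitelyCliqueHelly) (S : Set (Set V))
    (hf : S.Finite) (hS : ∀ C ∈ S, G.IsClique C) (hS' : ∀ A ∈ S, ∀ B ∈ S, (A ∩ B).Nonempty) :
    ∃ x, ∀ C ∈ S, ∀ y ∈ C, G.Near x y := by
  choose! K hK hCK using fun C hC => exists_maximal_clique (hS C hC)
  obtain ⟨x, hx⟩ := h (K '' S) (by rintro _ ⟨C, hC, rfl⟩; exact hK C hC) (hf.image _) (by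
    rintro _ ⟨A, hA, rfl⟩ _ ⟨B, hB, rfl⟩
    exact (hS' A hA B hB).mono (Set.inter_subset_inter (hCK A hA) (hCK B hB)))
  exact ⟨x, fun C hC y hy => isClique_iff_near.mp (hK C hC).1 x (hx _ ⟨C, hC, rfl⟩) y (hCK C hC hy)⟩

lemma IsCliqueHelly.isFinitelyCliqueHelly (h : G.IsCliqueHelly) : G.IsFinitelyCliqueHelly :=
  fun S hS _ hS' => h S hS hS'

lemma IsHelly.isFinitelyHelly (h : G.IsHelly) : G.IsFinitelyHelly :=
  fun S hS _ hS' => h S hS hS'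

/-- The vertex `z` is near at least two of the vertices `a`, `b`, `c`. -/
def NearTwo (G : SimpleGraph V) (a b c z : V) : Prop :=
  (G.Near z a ∧ G.Near z b) ∨ (G.Near z b ∧ G.Near z c) ∨ (G.Near z a ∧ G.Near z c)

/-- Sets containing two of the three vertices `a`, `b`, `c` always meet, so the cliques found here
for different `z` pairwise intersect. -/
lemma NearTwo.exists_clique {a b c z : V} (hab : G.Near a b) (hbc : G.Near b c)
    (hac : G.Near a c) (hz : G.NearTwo a b c z) :
    ∃ C, G.IsClique C ∧ z ∈ C ∧ ((a ∈ C ∧ b ∈ C) ∨ (b ∈ C ∧ c ∈ C) ∨ (a ∈ C ∧ c ∈ C)) := by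
  have key : ∀ p q, G.Near p q → G.Near z p → G.Near z q →
      G.IsClique ({z, p, q} : Set V) := by
    intro p q hpq hp hq
    refine isClique_iff_near.mpr ?_
    rintro x (rfl | rfl | rfl) y (rfl | rfl | rfl) <;>
      first | rfl | assumption | (symm; assumption)
  rcases hz with ⟨h1, h2⟩ | ⟨h1, h2⟩ | ⟨h1, h2⟩
  · exact ⟨_, key a b hab h1 h2, by simp, by simp⟩
  · exact ⟨_, key b c hbc h1 h2, by simp, by simp⟩
  · exact ⟨_, key a c hac h1 h2, by simp, by simp⟩

lemma inter_nonempty_of_two_of_three {α : Type*} {a b c : α} {A B : Set α}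
    (hA : (a ∈ A ∧ b ∈ A) ∨ (b ∈ A ∧ c ∈ A) ∨ (a ∈ A ∧ c ∈ A))
    (hB : (a ∈ B ∧ b ∈ B) ∨ (b ∈ B ∧ c ∈ B) ∨ (a ∈ B ∧ c ∈ B)) : (A ∩ B).Nonempty := by
  by_cases h : a ∈ A ∧ a ∈ B
  · exact ⟨a, h⟩
  · by_cases h' : b ∈ A ∧ b ∈ B
    · exact ⟨b, h'⟩
    · exact ⟨c, by tauto, by tauto⟩

/-- In a clique-Helly graph, the vertices near two of the vertices of a triangle have a common
near vertex. -/
lemma IsCliqueHelly.exists_near_triangle (h : G.IsCliqueHelly) {a b c : V} (hab : G.Near a b)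
    (hbc : G.Near b c) (hac : G.Near a c) (Z : Set V) (hZ : ∀ z ∈ Z, G.NearTwo a b c z) :
    ∃ x, ∀ z ∈ Z, G.Near x z := by
  choose! C hC hzC hC' using fun z hz => (hZ z hz).exists_clique hab hbc hac
  obtain ⟨x, hx⟩ := h.exists_near (C '' Z) (by rintro _ ⟨z, hz, rfl⟩; exact hC z hz) (by
    rintro _ ⟨z, hz, rfl⟩ _ ⟨w, hw, rfl⟩
    exact inter_nonempty_of_two_of_three (hC' z hz) (hC' w hw))
  exact ⟨x, fun z hz => hx _ ⟨z, hz, rfl⟩ z (hzC z hz)⟩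

lemma IsFinitelyCliqueHelly.exists_near_triangle (h : G.IsFinitelyCliqueHelly) {a b c : V}
    (hab : G.Near a b) (hbc : G.Near b c) (hac : G.Near a c) (Z : Set V) (hf : Z.Finite)
    (hZ : ∀ z ∈ Z, G.NearTwo a b c z) : ∃ x, ∀ z ∈ Z, G.Near x z := by
  choose! C hC hzC hC' using fun z hz => (hZ z hz).exists_clique hab hbc hac
  obtain ⟨x, hx⟩ := h.exists_near (C '' Z) (hf.image _)
    (by rintro _ ⟨z, hz, rfl⟩; exact hC z hz) (by
    rintro _ ⟨z, hz, rfl⟩ _ ⟨w, hw, rfl⟩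
    exact inter_nonempty_of_two_of_three (hC' z hz) (hC' w hw))
  exact ⟨x, fun z hz => hx _ ⟨z, hz, rfl⟩ z (hzC z hz)⟩

/-! ### Domination and the finite Helly property -/

/-- Every finite set of vertices of `B₁(v) ∩ B_{k+1}(u)`, where `d(u,v) ≤ k + 1`, is dominated,
together with `v`, by a vertex of `B_k(u)`. -/
def FinitelyDominated (G : SimpleGraph V) (u : V) : Prop :=
  ∀ (k : ℕ) (v : V) (F : Set V), F.Finite → G.dist u v ≤ k + 1 →
    (∀ y ∈ F, G.Near v y ∧ G.dist u y ≤ k + 1) →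
    ∃ p, G.dist u p ≤ k ∧ G.Near p v ∧ ∀ y ∈ F, G.Near p y

/-- The set `B₁(v) ∩ B_{k+1}(u)`, where `d(u,v) ≤ k + 1`, is dominated by a vertex of `B_k(u)`. -/
def BallDominated (G : SimpleGraph V) (u : V) : Prop :=
  ∀ (k : ℕ) (v : V), G.dist u v ≤ k + 1 →
    ∃ p, G.dist u p ≤ k ∧ ∀ y, G.Near v y → G.dist u y ≤ k + 1 → G.Near p y

lemma BallDominated.finitelyDominated {u : V} (h : G.BallDominated u) :
    G.FinitelyDominated u := by
  intro k v F _ hv hF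
  obtain ⟨p, hp, hp'⟩ := h k v hv
  exact ⟨p, hp, hp' v (Near.refl v) hv, fun y hy => hp' y (hF y hy).1 (hF y hy).2⟩

/-- The first step `y` of a geodesic to `w` may leave the ball of radius `k` around `u` by one
level. By induction, at level `k + 1`, it can be followed by a step `z` that rises no further; a
vertex dominating `v` and `z` from level `k` then replaces `y`. -/
lemma exists_near_geodesic (hG : G.Connected) (hD : ∀ u, G.FinitelyDominated u) (u w : V) :
    ∀ (r k : ℕ) (v : V), G.dist u v ≤ k → G.dist v w ≤ r + 1 → G.dist u w ≤ k + r →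
      ∃ y, G.Near v y ∧ G.dist y w ≤ r ∧ G.dist u y ≤ k := by
  intro r
  induction r with
  | zero =>
    intro k v h1 h2 h3
    exact ⟨w, hG.near_iff.mpr h2, by simp, h3⟩
  | succ r ih =>
    intro k v h1 h2 h3
    obtain ⟨y, hvy, hyw⟩ := hG.exists_near_dist h2
    have huy := hG.dist_le_of_near h1 hvy
    obtain ⟨z, hyz, hzw, huz⟩ := ih (k + 1) y huy hyw (by omega)
    obtain ⟨p, hp, hpy, hpF⟩ := hD u k y {v, z} (by simp) huy (by
      rintro x (rfl | rfl)
      · exact ⟨hvy.symm, by omega⟩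
      · exact ⟨hyz, huz⟩)
    refine ⟨p, (hpF v (by simp)).symm, ?_, hp⟩
    exact hG.dist_le_of_near' hzw (hpF z (by simp)).symm

/-- Induction on the number of balls. Take a common point `v` of the old balls closest to the new
centre. If it is outside the new ball, it has a step towards each old centre that moves no further
from the new one; a vertex dominating all these steps is closer to the new centre and still lies in
the old balls. -/
lemma isFinitelyHelly_of_finitelyDominated (hG : G.Connected) (hD : ∀ u, G.FinitelyDominated u) :
    G.IsFinitelyHelly := by
  have := hG.nonempty
  rw [hG.isFinitelyHelly_iff]
  intro S hS
  induction S, hS using Set.Finite.induction_on with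
  | empty => intro _; exact ⟨hG.nonempty.some, by simp⟩
  | @insert a S _ hS ih =>
    intro hd
    have hne : ∃ n v, (∀ b ∈ S, G.dist b.1 v ≤ b.2) ∧ G.dist a.1 v = n := by
      obtain ⟨v, hv⟩ := ih (fun b hb c hc => hd b (Or.inr hb) c (Or.inr hc))
      exact ⟨_, v, hv, rfl⟩
    classical
    obtain ⟨v, hv, hva⟩ := Nat.find_spec hne
    have hmin : ∀ x, (∀ b ∈ S, G.dist b.1 x ≤ b.2) → G.dist a.1 v ≤ G.dist a.1 x := by
      intro x hx
      rw [hva]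
      exact Nat.find_min' hne ⟨x, hx, rfl⟩
    by_cases hk : G.dist a.1 v ≤ a.2
    · refine ⟨v, ?_⟩
      rintro b (rfl | hb)
      · exact hk
      · exact hv b hb
    exfalso
    obtain ⟨k, hk'⟩ : ∃ k, G.dist a.1 v = k + 1 := ⟨G.dist a.1 v - 1, by omega⟩
    have hy : ∀ b ∈ S, ∃ y, G.Near v y ∧ G.dist y b.1 ≤ b.2 - 1 ∧ G.dist a.1 y ≤ k + 1 ∧
        1 ≤ b.2 := by
      intro b hb
      have h1 := hd a (Or.inl rfl) b (Or.inr hb)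
      have h2 := hv b hb
      -- The step towards `b.1` aims at distance `b.2 - 1`. With radius zero, `v` would be the
      -- centre `b.1`, which is already in the ball of `a`.
      have h3 : 1 ≤ b.2 := by
        by_contra h0
        have : b.1 = v := hG.dist_eq_zero_iff.mp (by omega)
        rw [this] at h1
        omega
      obtain ⟨y, h4, h5, h6⟩ := exists_near_geodesic hG hD a.1 b.1 (b.2 - 1) (k + 1) v hk'.le
        (by rw [dist_comm]; omega) (by omega)
      exact ⟨y, h4, h5, h6, h3⟩
    choose! y hy1 hy2 hy3 hy4 using hy
    obtain ⟨p, hp, hpv, hpy⟩ := hD a.1 k v (y '' S) (hS.image y) hk'.le (by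
      rintro _ ⟨b, hb, rfl⟩
      exact ⟨hy1 b hb, hy3 b hb⟩)
    have := hmin p (fun b hb => by
      have h1 := hG.dist_le_of_near' (hy2 b hb) (hpy _ ⟨b, hb, rfl⟩).symm
      have h2 := hy4 b hb
      rw [dist_comm]
      omega)
    omega

end SimpleGraph

/-! ### Weak modularity, unit balls and ball domination -/

namespace SimpleGraph

variable {V : Type*} {G : SimpleGraph V}

lemma Connected.dist_le_two (hG : G.Connected) {a b x : V} (ha : G.Near a x) (hb : G.Near b x) :
    G.dist a b ≤ 2 := by
  have h1 := hG.dist_triangle (u := a) (v := x) (w := b)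
  have h2 := ha.dist_le
  have h3 := hb.symm.dist_le
  omega

/-- The ball of radius `k` around `u` meets the unit balls around the vertices to be dominated
because of their distance to `u`, and these unit balls share `v`. -/
lemma IsHelly.ballDominated (h : G.IsHelly) (hG : G.Connected) (u : V) : G.BallDominated u := by
  intro k v hv
  rw [hG.isHelly_iff] at h
  obtain ⟨p, hp⟩ := h (insert (u, k) ((fun y => (y, 1)) '' {y | G.Near v y ∧ G.dist u y ≤ k + 1}))
    (by
      rintro _ (rfl | ⟨y, ⟨hy1, hy2⟩, rfl⟩) _ (rfl | ⟨z, ⟨hz1, hz2⟩, rfl⟩)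
      · simp
      · exact hz2
      · rw [dist_comm]; simpa [add_comm] using hy2
      · exact hG.dist_le_two hy1.symm hz1.symm)
  refine ⟨p, hp _ (Or.inl rfl), fun y h1 h2 => ?_⟩
  exact (hG.near_iff.mpr (hp _ (Or.inr ⟨y, ⟨h1, h2⟩, rfl⟩))).symm

lemma IsFinitelyHelly.finitelyDominated (h : G.IsFinitelyHelly) (hG : G.Connected) (u : V) :
    G.FinitelyDominated u := by
  intro k v F hF hv hFv
  rw [hG.isFinitelyHelly_iff] at h
  have hFv' : ∀ y ∈ insert v F, G.Near v y ∧ G.dist u y ≤ k + 1 := by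
    rintro y (rfl | hy)
    · exact ⟨Near.rfl, hv⟩
    · exact hFv y hy
  obtain ⟨p, hp⟩ := h (insert (u, k) ((fun y => (y, 1)) '' insert v F))
    (((hF.insert v).image _).insert _)
    (by
      rintro _ (rfl | ⟨y, hy, rfl⟩) _ (rfl | ⟨z, hz, rfl⟩)
      · simp
      · exact (hFv' z hz).2
      · rw [dist_comm]; simpa [add_comm] using (hFv' y hy).2
      · exact hG.dist_le_two (hFv' y hy).1.symm (hFv' z hz).1.symm)
  have key : ∀ y ∈ insert v F, G.Near p y := fun y hy =>
    (hG.near_iff.mpr (hp _ (Or.inr ⟨y, hy, rfl⟩))).symm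
  exact ⟨p, hp _ (Or.inl rfl), key v (Or.inl rfl), fun y hy => key y (Or.inr hy)⟩

lemma FinitelyDominated.triangleCondition (hG : G.Connected) {u : V}
    (h : G.FinitelyDominated u) : G.TriangleCondition u := by
  intro v w hvw h1 h2
  obtain ⟨k, hk⟩ : ∃ k, G.dist u v = k + 1 := ⟨G.dist u v - 1, by omega⟩
  obtain ⟨p, hp, hpv, hpw⟩ := h k v {w} (by simp) hk.le (by
    rintro y rfl
    exact ⟨hG.near_iff.mpr hvw.le, by omega⟩)
  have h3 := hG.dist_le_of_near (le_refl (G.dist u p)) hpv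
  refine ⟨p, hpv.adj ?_, (hpw w rfl).adj ?_, by omega⟩
  · rintro rfl; omega
  · rintro rfl; omega

lemma FinitelyDominated.quadrangleCondition (hG : G.Connected) {u : V}
    (h : G.FinitelyDominated u) : G.QuadrangleCondition u := by
  intro v w z hvz hwz hvw h2 huv huz
  obtain ⟨k, hk⟩ : ∃ k, G.dist u v = k + 1 := ⟨G.dist u v - 1, by omega⟩
  -- The first domination replaces `z` by a vertex `p` that may still be on the level of `v` and
  -- `w`; a second one, around `p`, goes below that level.
  obtain ⟨p, hp, -, hpF⟩ := h (k + 1) z {v, w} (by simp) (by omega) (by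
    rintro y (rfl | rfl)
    · exact ⟨(hG.near_iff.mpr hvz.le).symm, by omega⟩
    · exact ⟨(hG.near_iff.mpr hwz.le).symm, by omega⟩)
  obtain ⟨x, hx, -, hxF⟩ := h k p {v, w} (by simp) hp (by
    intro y hy
    refine ⟨hpF y hy, ?_⟩
    rcases hy with rfl | rfl <;> omega)
  have h3 := hG.dist_le_of_near (le_refl (G.dist u x)) (hxF v (by simp))
  refine ⟨x, (hxF v (by simp)).adj ?_, (hxF w (by simp)).adj ?_, by omega⟩
  · rintro rfl; omega
  · rintro rfl; omega

lemma isWeaklyModular_of_finitelyDominated (hG : G.Connected)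
    (h : ∀ u, G.FinitelyDominated u) : G.IsWeaklyModular :=
  fun u => ⟨(h u).triangleCondition hG, (h u).quadrangleCondition hG⟩

lemma IsHelly.isOneHelly (h : G.IsHelly) : G.IsOneHelly :=
  fun S hS => h S fun _ hA => (hS hA).imp fun _ hv => ⟨1, hv⟩

lemma Connected.exists_adj_dist (hG : G.Connected) {u v : V} {k : ℕ} (h : G.dist u v = k + 1) :
    ∃ y, G.Adj v y ∧ G.dist u y = k := by
  obtain ⟨y, h1, h2⟩ := hG.exists_near_dist (u := v) (v := u) (r := k) (by rw [dist_comm]; omega)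
  rw [dist_comm] at h2
  have h3 := hG.dist_le_of_near (le_refl (G.dist u y)) h1.symm
  refine ⟨y, h1.adj ?_, by omega⟩
  rintro rfl
  omega

/-- In a weakly modular `1`-Helly graph, the neighbours of `v` that are closer to `u` are
dominated by a vertex at distance `d(u, v) - 2` from `u`. -/
lemma exists_near_lower_neighbors (hG : G.Connected) (h1 : G.IsOneHelly) (h : G.IsWeaklyModular)
    (u : V) : ∀ (k : ℕ) (v : V), G.dist u v = k + 2 →
      ∃ q, G.dist u q ≤ k ∧ ∀ y, G.Adj v y → G.dist u y = k + 1 → G.Near q y := by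
  rw [hG.isOneHelly_iff] at h1
  intro k
  induction k with
  | zero =>
    intro v _
    exact ⟨u, by simp, fun y _ hy => hG.near_iff.mpr (by omega)⟩
  | succ k ih =>
    intro v hv
    obtain ⟨y₀, hy₀, hy₀'⟩ := hG.exists_adj_dist (k := k + 2) hv
    obtain ⟨q₀, hq₀, hq₀'⟩ := ih y₀ hy₀'
    -- The vertices `y` and `y₀` have a common near vertex one level down: by descent if they are
    -- equal, by the triangle condition if adjacent, by the quadrangle condition otherwise. It is
    -- near `q₀`.
    have key : ∀ y, G.Adj v y → G.dist u y = k + 2 → G.dist y q₀ ≤ 2 := by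
      intro y hy hy'
      have : ∃ z, G.Adj z y ∧ G.Adj z y₀ ∧ G.dist u z = k + 1 := by
        have h2 : G.dist y y₀ ≤ 2 := hG.dist_le_two hy.symm.near hy₀.symm.near
        interval_cases h3 : G.dist y y₀
        · rw [hG.dist_eq_zero_iff] at h3
          subst h3
          obtain ⟨z, h4, h5⟩ := hG.exists_adj_dist (k := k + 1) hy'
          exact ⟨z, h4.symm, h4.symm, h5⟩
        · obtain ⟨z, h4, h5, h6⟩ := (h u).1 y y₀ h3 (by omega) (by omega)
          exact ⟨z, h4, h5, by omega⟩
        · obtain ⟨z, h4, h5, h6⟩ := (h u).2 y y₀ v (dist_eq_one_iff_adj.mpr hy.symm)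
            (dist_eq_one_iff_adj.mpr hy₀.symm) h3 (by omega) (by omega) (by omega)
          exact ⟨z, h4, h5, by omega⟩
      obtain ⟨z, h4, h5, h6⟩ := this
      exact hG.dist_le_two h4.symm.near (hq₀' z h5.symm h6)
    obtain ⟨q, hq⟩ := h1 (insert q₀ {y | G.Adj v y ∧ G.dist u y = k + 2}) (by
      rintro a (rfl | ⟨ha, ha'⟩) b (rfl | ⟨hb, hb'⟩)
      · simp
      · rw [dist_comm]; exact key b hb hb'
      · exact key a ha ha'
      · exact hG.dist_le_two ha.symm.near hb.symm.near)
    exact ⟨q, hG.dist_le_of_near hq₀ (hq q₀ (Or.inl rfl)),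
      fun y hy hy' => (hq y (Or.inr ⟨hy, hy'⟩)).symm⟩

/-- If `v` is on the top level, let `q` lie two levels lower and dominate the lower neighbours of
`v`. It is within distance 2 of the whole set, since a neighbour of `v` on the same level shares a
lower neighbour with `v` by the triangle condition. A common vertex of the unit balls is at most one
level above `q`. -/
lemma IsWeaklyModular.ballDominated (h : G.IsWeaklyModular) (hG : G.Connected)
    (h1 : G.IsOneHelly) (u : V) : G.BallDominated u := by
  intro k v hv
  rcases Nat.le_or_eq_of_le_succ hv with hv | hv
  · exact ⟨v, hv, fun y hy _ => hy⟩
  cases k with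
  | zero => exact ⟨u, by simp, fun y _ hy => hG.near_iff.mpr hy⟩
  | succ k =>
    obtain ⟨q, hq, hq'⟩ := exists_near_lower_neighbors hG h1 h u k v hv
    rw [hG.isOneHelly_iff] at h1
    have key : ∀ y, G.Near v y → G.dist u y ≤ k + 2 → G.dist q y ≤ 2 := by
      rintro y (rfl | hy) hy'
      · obtain ⟨z, h2, h3⟩ := hG.exists_adj_dist (k := k + 1) hv
        exact hG.dist_le_two (hq' z h2 h3) h2.near
      · by_cases h2 : G.dist u y = k + 2
        · obtain ⟨z, h4, h5, h6⟩ := (h u).1 v y (dist_eq_one_iff_adj.mpr hy) (by omega) (by omega)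
          exact hG.dist_le_two (hq' z h4.symm (by omega)) h5.symm.near
        · have h3 := hG.dist_le_of_near (le_refl (G.dist u y)) hy.symm.near
          exact (hq' y hy (by omega)).dist_le.trans (by norm_num)
    obtain ⟨p, hp⟩ := h1 (insert q {y | G.Near v y ∧ G.dist u y ≤ k + 2}) (by
      rintro a (rfl | ⟨ha, ha'⟩) b (rfl | ⟨hb, hb'⟩)
      · simp
      · exact key b hb hb'
      · rw [dist_comm]; exact key a ha ha'
      · exact hG.dist_le_two ha.symm hb.symm)
    exact ⟨p, hG.dist_le_of_near hq (hp q (Or.inl rfl)),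
      fun y hy hy' => (hp y (Or.inr ⟨hy, hy'⟩)).symm⟩

/-- Consider the least amount by which all radii must be increased to obtain a common vertex `v`. If
it is positive, decrease it by one: inside the unit ball around `v`, each ball then coincides with a
unit ball. These traces pairwise meet by the finite Helly property, so the unit-ball property
contradicts minimality. -/
lemma IsOneHelly.isHelly (h1 : G.IsOneHelly) (hG : G.Connected) (hD : ∀ u, G.BallDominated u) :
    G.IsHelly := by
  have hF := isFinitelyHelly_of_finitelyDominated hG fun u => (hD u).finitelyDominated
  rw [hG.isOneHelly_iff] at h1
  rw [hG.isFinitelyHelly_iff] at hF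
  rw [hG.isHelly_iff]
  intro S hS
  rcases S.eq_empty_or_nonempty with rfl | ⟨a₀, ha₀⟩
  · exact ⟨hG.nonempty.some, by simp⟩
  have hE : ∃ m v, ∀ a ∈ S, G.dist a.1 v ≤ a.2 + m := ⟨a₀.2, a₀.1, fun a ha => hS a ha a₀ ha₀⟩
  classical
  obtain ⟨v, hv⟩ := Nat.find_spec hE
  rcases hm : Nat.find hE with _ | m
  · exact ⟨v, fun a ha => by have := hv a ha; rwa [hm] at this⟩
  rw [hm] at hv
  by_cases h0 : ∃ a ∈ S, a.2 = 0
  · obtain ⟨a, ha, h0⟩ := h0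
    exact ⟨a.1, fun b hb => by simpa [h0] using hS b hb a ha⟩
  push Not at h0
  exfalso
  -- One domination descends from level `a.2 + m + 1` to `a.2 + m`, a second one to `r = a.2 + m -
  -- 1`. Vertices near `q` are thus within `a.2 + m`, which gives the reverse implication.
  -- Positivity of `a.2` makes room for the second descent.
  have hq : ∀ a ∈ S, ∃ q, ∀ x, G.Near v x → (G.dist a.1 x ≤ a.2 + m ↔ G.Near q x) := by
    intro a ha
    obtain ⟨p, -, hp⟩ := hD a.1 (a.2 + m) v (hv a ha)
    obtain ⟨r, hr⟩ : ∃ r, a.2 + m = r + 1 := ⟨a.2 + m - 1, by have := h0 a ha; omega⟩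
    obtain ⟨p', hp1, hp'⟩ := hD a.1 (a.2 + m) v (hv a ha)
    rw [hr] at hp1
    obtain ⟨q, hq1, hq⟩ := hD a.1 r p' hp1
    refine ⟨q, fun x hx => ⟨fun hax => ?_, fun hqx => ?_⟩⟩
    · exact hq x (hp' x hx (hax.trans (Nat.le_succ _))) (by omega)
    · rw [hr]
      exact hG.dist_le_of_near hq1 hqx
  have : Nonempty V := hG.nonempty
  choose! q hq using hq
  have hpair : ∀ a ∈ S, ∀ b ∈ S, ∃ x, G.Near v x ∧ G.Near (q a) x ∧ G.Near (q b) x := by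
    intro a ha b hb
    obtain ⟨x, hx⟩ := hF {(v, 1), (a.1, a.2 + m), (b.1, b.2 + m)} (by simp) (by
      have h1 := hv a ha
      have h2 := hv b hb
      have h3 := hS a ha b hb
      have h1' := dist_comm (G := G) (u := a.1) (v := v) ▸ h1
      have h2' := dist_comm (G := G) (u := b.1) (v := v) ▸ h2
      have h3' := dist_comm (G := G) (u := a.1) (v := b.1) ▸ h3
      rintro _ (rfl | rfl | rfl) _ (rfl | rfl | rfl) <;> simp <;> omega)
    have hx1 : G.Near v x := hG.near_iff.mpr (hx (v, 1) (by simp))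
    exact ⟨x, hx1, (hq a ha x hx1).mp (hx (a.1, a.2 + m) (by simp)),
      (hq b hb x hx1).mp (hx (b.1, b.2 + m) (by simp))⟩
  obtain ⟨x, hx⟩ := h1 (insert v (q '' S)) (by
    rintro _ (rfl | ⟨a, ha, rfl⟩) _ (rfl | ⟨b, hb, rfl⟩)
    · simp
    · obtain ⟨x, h2, h3, -⟩ := hpair b hb b hb
      exact hG.dist_le_two h2 h3
    · obtain ⟨x, h2, h3, -⟩ := hpair a ha a ha
      exact hG.dist_le_two h3 h2
    · obtain ⟨x, -, h2, h3⟩ := hpair a ha b hb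
      exact hG.dist_le_two h2 h3)
  have hvx := hx v (Or.inl rfl)
  exact Nat.find_min hE (m := m) (by omega)
    ⟨x, fun a ha => (hq a ha x hvx).mpr (hx _ (Or.inr ⟨a, ha, rfl⟩))⟩

/-! ### Unit balls in finitely Helly, clique-Helly graphs -/

/-- A common near vertex `y` of `v`, `w`, `w'` that dominates all vertices of
`B₁(v) ∩ B₂(w) ∩ B₂(w')`. -/
def IsCenter (G : SimpleGraph V) (v w w' y : V) : Prop :=
  G.Near v y ∧ G.Near w y ∧ G.Near w' y ∧
    ∀ z, G.Near v z → G.dist w z ≤ 2 → G.dist w' z ≤ 2 → G.Near y z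

lemma IsCenter.symm {v w w' y : V} (h : G.IsCenter v w w' y) : G.IsCenter v w' w y :=
  ⟨h.1, h.2.2.1, h.2.1, fun z h1 h2 h3 => h.2.2.2 z h1 h3 h2⟩

/-- The finite Helly property for unit balls. -/
lemma IsFinitelyHelly.exists_near (h : G.IsFinitelyHelly) (hG : G.Connected) (S : Set V)
    (hf : S.Finite) (hS : ∀ a ∈ S, ∀ b ∈ S, G.dist a b ≤ 2) : ∃ x, ∀ a ∈ S, G.Near a x := by
  rw [hG.isFinitelyHelly_iff] at h
  obtain ⟨x, hx⟩ := h ((fun a => (a, 1)) '' S) (hf.image _) (by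
    rintro _ ⟨a, ha, rfl⟩ _ ⟨b, hb, rfl⟩
    exact hS a ha b hb)
  exact ⟨x, fun a ha => hG.near_iff.mpr (hx _ ⟨a, ha, rfl⟩)⟩

/-- Zorn's lemma on the common near vertices of `v`, `w`, `w'`, compared by the vertices of `Z` that
they are near. For maximal `m` and `z` in `Z`, finite Hellyness gives `b` near `v`, `w`, `w'`, `m`,
`z`; the triangle `m`, `b`, `v` then gives a vertex above `m` and near `z`, so `m` is near `z`. -/
lemma IsCliqueHelly.exists_isCenter (hc : G.IsCliqueHelly) (hG : G.Connected)
    (hF : G.IsFinitelyHelly) {v w w' : V} (h1 : G.dist v w ≤ 2) (h2 : G.dist v w' ≤ 2)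
    (h3 : G.dist w w' ≤ 2) : ∃ y, G.IsCenter v w w' y := by
  set A : Set V := {x | G.Near v x ∧ G.Near w x ∧ G.Near w' x} with hA
  set Z : Set V := {z | G.Near v z ∧ G.dist w z ≤ 2 ∧ G.dist w' z ≤ 2} with hZ
  have hAZ : A ⊆ Z := fun x hx =>
    ⟨hx.1, hx.2.1.dist_le.trans (by norm_num), hx.2.2.dist_le.trans (by norm_num)⟩
  obtain ⟨a₀, ha₀⟩ : A.Nonempty := by
    obtain ⟨x, hx⟩ := hF.exists_near hG {v, w, w'} (by simp) (by
      have h1' := dist_comm (G := G) (u := v) (v := w) ▸ h1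
      have h2' := dist_comm (G := G) (u := v) (v := w') ▸ h2
      have h3' := dist_comm (G := G) (u := w) (v := w') ▸ h3
      rintro _ (rfl | rfl | rfl) _ (rfl | rfl | rfl) <;> simp_all)
    exact ⟨x, hx v (by simp), hx w (by simp), hx w' (by simp)⟩
  let r : A → A → Prop := fun x y => ∀ z ∈ Z, G.Near x.1 z → G.Near y.1 z
  obtain ⟨m, hm⟩ : ∃ m : A, ∀ a, r m a → r a m := by
    refine exists_maximal_of_chains_bounded (r := r) (fun c hch => ?_)
      (fun h h' z hz hxz => h' z hz (h z hz hxz))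
    rcases c.eq_empty_or_nonempty with rfl | ⟨x₀, hx₀⟩
    · exact ⟨⟨a₀, ha₀⟩, by simp⟩
    have hr : ∀ x, r x x := fun x z _ h => h
    have hnear : ∀ x y, r x y → G.Near y.1 x.1 := fun x y h => h x.1 (hAZ x.2) Near.rfl
    have htot : ∀ x ∈ c, ∀ y ∈ c, r x y ∨ r y x := by
      intro x hx y hy
      by_cases hxy : x = y
      · exact Or.inl (hxy ▸ hr x)
      · exact hch hx hy hxy
    -- Comparable elements are near, because the candidates belong to `Z`. So the part of the chain
    -- above `x`, with any vertex near all of it, is a clique; these parts are nested, hence the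
    -- cliques pairwise meet, and a vertex near all of them bounds the chain.
    obtain ⟨p, hp⟩ := hc.exists_near
      {C | ∃ x ∈ c, ∃ z, (∀ y ∈ c, r x y → G.Near y.1 z) ∧
        C = insert z (Subtype.val '' {y | y ∈ c ∧ r x y})} (by
      rintro C ⟨x, hx, z, hz, rfl⟩
      refine isClique_iff_near.mpr ?_
      rintro _ (rfl | ⟨y, ⟨hy, hxy⟩, rfl⟩) _ (rfl | ⟨y', ⟨hy', hxy'⟩, rfl⟩)
      · rfl
      · exact (hz _ hy' hxy').symm
      · exact hz _ hy hxy
      · exact (htot y hy y' hy').elim (fun h => (hnear _ _ h).symm) (fun h => hnear _ _ h)) (by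
      rintro _ ⟨x, hx, z, hz, rfl⟩ _ ⟨x', hx', z', hz', rfl⟩
      rcases htot x hx x' hx' with h | h
      · exact ⟨x'.1, Or.inr ⟨x', ⟨hx', h⟩, rfl⟩, Or.inr ⟨x', ⟨hx', hr _⟩, rfl⟩⟩
      · exact ⟨x.1, Or.inr ⟨x, ⟨hx, hr _⟩, rfl⟩, Or.inr ⟨x, ⟨hx, h⟩, rfl⟩⟩)
    have key : ∀ x ∈ c, ∀ z, (∀ y ∈ c, r x y → G.Near y.1 z) → G.Near p z :=
      fun x hx z hz => hp _ ⟨x, hx, z, hz, rfl⟩ z (Or.inl rfl)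
    refine ⟨⟨p, (key x₀ hx₀ v fun y _ _ => y.2.1.symm).symm,
      (key x₀ hx₀ w fun y _ _ => y.2.2.1.symm).symm,
      (key x₀ hx₀ w' fun y _ _ => y.2.2.2.symm).symm⟩, fun x hx z hz hxz => ?_⟩
    exact key x hx z fun y _ hxy => hxy z hz hxz
  refine ⟨m.1, m.2.1, m.2.2.1, m.2.2.2, fun z hz1 hz2 hz3 => ?_⟩
  have hmA := m.2
  obtain ⟨b, hb⟩ := hF.exists_near hG {v, w, w', m.1, z} (by simp) (by
    have hmz : G.dist m.1 z ≤ 2 := hG.dist_le_two m.2.1.symm hz1.symm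
    have e1 : G.dist v m.1 ≤ 2 := hmA.1.dist_le.trans (by norm_num)
    have e2 : G.dist w m.1 ≤ 2 := hmA.2.1.dist_le.trans (by norm_num)
    have e3 : G.dist w' m.1 ≤ 2 := hmA.2.2.dist_le.trans (by norm_num)
    have e4 : G.dist v z ≤ 2 := hz1.dist_le.trans (by norm_num)
    intro a ha b hb
    simp only [Set.mem_insert_iff, Set.mem_singleton_iff] at ha hb
    rcases ha with rfl | rfl | rfl | rfl | rfl <;> rcases hb with rfl | rfl | rfl | rfl | rfl <;>
      first | assumption | simp | (rw [dist_comm]; assumption))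
  have hbv := hb v (by simp)
  have hbw := hb w (by simp)
  have hbw' := hb w' (by simp)
  have hbm := hb m.1 (by simp)
  have hbz := hb z (by simp)
  obtain ⟨c, hcc⟩ := hc.exists_near_triangle hmA.1 hbm hbv
    ({w, w'} ∪ {y | G.Near v y ∧ (G.Near m.1 y ∨ G.Near b y)}) (by
    rintro y ((rfl | rfl) | ⟨h4, h5 | h5⟩)
    · exact Or.inr (Or.inl ⟨hmA.2.1, hbw⟩)
    · exact Or.inr (Or.inl ⟨hmA.2.2, hbw'⟩)
    · exact Or.inl ⟨h4.symm, h5.symm⟩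
    · exact Or.inr (Or.inr ⟨h4.symm, h5.symm⟩))
  have hcA : c ∈ A := ⟨(hcc v (Or.inr ⟨Near.rfl, Or.inl hmA.1.symm⟩)).symm,
    (hcc w (by simp)).symm, (hcc w' (by simp)).symm⟩
  exact hm ⟨c, hcA⟩ (fun y hy h => hcc y (Or.inr ⟨hy.1, Or.inl h⟩)) z ⟨hz1, hz2, hz3⟩
    (hcc z (Or.inr ⟨hz1, Or.inr hbz.symm⟩))

/-- For a fixed `v` in `S`, the centers of `v`, `w`, `w'` with `w'` in `S` form, together with `w`,
a clique `K w`. As centers are symmetric in `w` and `w'`, any two of these cliques meet, and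
clique-Hellyness gives a vertex near every `w`. -/
lemma IsFinitelyHelly.isOneHelly (hF : G.IsFinitelyHelly) (hG : G.Connected)
    (hc : G.IsCliqueHelly) : G.IsOneHelly := by
  rw [hG.isOneHelly_iff]
  intro S hS
  rcases S.eq_empty_or_nonempty with rfl | ⟨v, hv⟩
  · exact ⟨hG.nonempty.some, by simp⟩
  let K : V → Set V := fun w => insert w {x | ∃ w' ∈ S, G.IsCenter v w w' x}
  have hK : ∀ w ∈ S, G.IsClique (K w) := by
    intro w hw
    refine isClique_iff_near.mpr ?_
    rintro a (rfl | ⟨w', hw', ha⟩) b (rfl | ⟨w'', hw'', hb⟩)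
    · rfl
    · exact hb.2.1
    · exact ha.2.1.symm
    -- The vertex `t` is among those dominated by `b`. Through `t`, the center `b` is within
    -- distance 2 of `w'`, so it is itself dominated by `a`.
    · obtain ⟨t, ht⟩ := hF.exists_near hG {v, w, w', w''} (by simp) (by
        intro a ha b hb
        have hsub : ({v, w, w', w''} : Set V) ⊆ S := by
          rintro x (rfl | rfl | rfl | rfl) <;> assumption
        exact hS a (hsub ha) b (hsub hb))
      have htv := ht v (by simp)
      have htw := (ht w (by simp)).dist_le.trans one_le_two
      have htw' := ht w' (by simp)
      have htw'' := (ht w'' (by simp)).dist_le.trans one_le_two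
      have hbt : G.Near b t := hb.2.2.2 t htv htw htw''
      exact ha.2.2.2 b hb.1 (hb.2.1.dist_le.trans one_le_two) (hG.dist_le_two htw' hbt)
  obtain ⟨x, hx⟩ := hc.exists_near (K '' S) (by rintro _ ⟨w, hw, rfl⟩; exact hK w hw) (by
    rintro _ ⟨w, hw, rfl⟩ _ ⟨w', hw', rfl⟩
    obtain ⟨y, hy⟩ := hc.exists_isCenter hG hF (hS v hv w hw) (hS v hv w' hw') (hS w hw w' hw')
    exact ⟨y, Or.inr ⟨w', hw', hy⟩, Or.inr ⟨w, hw, hy.symm⟩⟩)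
  exact ⟨x, fun w hw => (hx _ ⟨w, hw, rfl⟩ w (Or.inl rfl)).symm⟩

lemma IsFinitelyHelly.isHelly (hF : G.IsFinitelyHelly) (hG : G.Connected)
    (hc : G.IsCliqueHelly) : G.IsHelly := by
  have h1 := hF.isOneHelly hG hc
  exact h1.isHelly hG
    ((isWeaklyModular_of_finitelyDominated hG (hF.finitelyDominated hG)).ballDominated hG h1)

/-! ### Clique-Hellyness and dismantlability from the Helly property -/

/-- A point near all vertices of a maximal clique belongs to it. -/
lemma IsHelly.isCliqueHelly (h : G.IsHelly) (hG : G.Connected) : G.IsCliqueHelly := by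
  intro S hS hS'
  obtain ⟨x, hx⟩ := hG.isOneHelly_iff.mp h.isOneHelly (⋃₀ S) (by
    rintro a ⟨A, hA, ha⟩ b ⟨B, hB, hb⟩
    obtain ⟨c, hcA, hcB⟩ := hS' A hA B hB
    exact hG.dist_le_two (isClique_iff_near.mp (hS hA).1 a ha c hcA)
      (isClique_iff_near.mp (hS hB).1 b hb c hcB))
  exact ⟨x, fun A hA => mem_of_maximal_clique (hS hA) fun y hy => (hx y ⟨A, hA, hy⟩).symm⟩

/-- With finite cliques, finitely many of them have a finite union, so the finite Helly property
applies to the unit balls around all its vertices. -/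
lemma IsFinitelyHelly.isFinitelyCliqueHelly (h : G.IsFinitelyHelly) (hG : G.Connected)
    (hK : ∀ K : Set V, G.IsClique K → K.Finite) : G.IsFinitelyCliqueHelly := by
  intro S hS hf hS'
  obtain ⟨x, hx⟩ := h.exists_near hG (⋃₀ S) (hf.sUnion fun K hKS => hK K (hS hKS).1) (by
    rintro a ⟨A, hA, ha⟩ b ⟨B, hB, hb⟩
    obtain ⟨c, hcA, hcB⟩ := hS' A hA B hB
    exact hG.dist_le_two (isClique_iff_near.mp (hS hA).1 a ha c hcA)
      (isClique_iff_near.mp (hS hB).1 b hb c hcB))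
  exact ⟨x, fun A hA => mem_of_maximal_clique (hS hA) fun y hy => (hx y ⟨A, hA, hy⟩).symm⟩

lemma IsHelly.isDismantlable (h : G.IsHelly) (hG : G.Connected) : G.IsDismantlable := by
  obtain ⟨u⟩ := hG.nonempty
  -- Breadth-first order: distance from `u`, with ties broken by an arbitrary well-order. The
  -- vertices up to `v` are no further from `u` than `v`, so ball domination supplies the required
  -- vertex on a lower level.
  let r : V → V → Prop := InvImage (Prod.Lex (· < ·) WellOrderingRel) fun v => (G.dist u v, v)
  have hinj : Function.Injective fun v => (G.dist u v, v) := fun a b hab => (Prod.ext_iff.mp hab).2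
  refine ⟨r, (RelEmbedding.preimage ⟨_, hinj⟩ (Prod.Lex (· < ·) WellOrderingRel)).isWellOrder, ?_⟩
  have hle : ∀ {x y}, r x y → G.dist u x ≤ G.dist u y := by
    intro x y hxy
    rcases Prod.lex_def.mp hxy with h | h
    · exact h.le
    · exact h.1.le
  rintro v ⟨z, hz⟩
  have hv : v ≠ u := by
    rintro rfl
    have h0 := hle hz
    rw [dist_self, Nat.le_zero, hG.dist_eq_zero_iff] at h0
    subst h0
    rcases Prod.lex_def.mp hz with h | h
    · exact lt_irrefl _ h
    · exact irrefl _ h.2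
  have hpos : G.dist u v ≠ 0 := fun h0 => hv (hG.dist_eq_zero_iff.mp h0).symm
  obtain ⟨k, hk⟩ := Nat.exists_eq_succ_of_ne_zero hpos
  obtain ⟨p, hp, hp'⟩ := h.ballDominated hG u k v hk.le
  have hlt : G.dist u p < G.dist u v := by omega
  refine ⟨p, Prod.lex_def.mpr (Or.inl hlt), ((hp' v Near.rfl hk.le).adj ?_).symm, ?_⟩
  · rintro rfl; exact lt_irrefl _ hlt
  · intro x hx hvx
    have hux : G.dist u x ≤ k + 1 := by
      rcases hx with rfl | hx
      · exact hk.le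
      · exact (hle hx).trans hk.le
    have := hp' x (hvx.elim (fun h => Or.inl h.symm) Or.inr) hux
    exact this.elim (fun h => Or.inl h.symm) Or.inr

end SimpleGraph

/-! ### Growing the universal cover ball by ball -/

namespace SimpleGraph

universe u

variable {V : Type u} {G : SimpleGraph V}

/-- A set of points over the vertices of `G`, with an adjacency relation. -/
structure Sheet (G : SimpleGraph V) where
  /-- The points of the sheet. -/
  carrier : Type u
  /-- The projection to the vertices of the graph. -/
  proj : carrier → V
  /-- The adjacency relation. -/
  adj : carrier → carrier → Prop
  adj_refl : ∀ x, adj x x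
  adj_symm : ∀ {x y}, adj x y → adj y x
  near_of_adj : ∀ {x y}, adj x y → G.Near (proj x) (proj y)

namespace Sheet

/-- Points of a sheet with a vertex near their projections. -/
def Extension (L : G.Sheet) : Type u := {q : L.carrier × V // G.Near (L.proj q.1) q.2}

/-- Extensions of adjacent points by the same vertex are identified. -/
def Extension.Rel (L : G.Sheet) (p q : L.Extension) : Prop := p.1.2 = q.1.2 ∧ L.adj p.1.1 q.1.1

/-- The extension of a sheet by the neighbours of its points. -/
def next (L : G.Sheet) : G.Sheet where
  carrier := Quot (Extension.Rel L)
  proj := Quot.lift (fun q => q.1.2) fun _ _ h => h.1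
  adj x y := ∃ (b : L.carrier) (v w : V) (hv : G.Near (L.proj b) v) (hw : G.Near (L.proj b) w),
    x = Quot.mk _ ⟨(b, v), hv⟩ ∧ y = Quot.mk _ ⟨(b, w), hw⟩ ∧ G.Near v w
  adj_refl := by
    rintro ⟨⟨⟨b, v⟩, hv⟩⟩
    exact ⟨b, v, v, hv, hv, rfl, rfl, Near.rfl⟩
  adj_symm := by
    rintro x y ⟨b, v, w, hv, hw, hx, hy, h⟩
    exact ⟨b, w, v, hw, hv, hy, hx, h.symm⟩
  near_of_adj := by
    rintro x y ⟨b, v, w, hv, hw, rfl, rfl, h⟩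
    exact h

/-- The extension of a point by a vertex. -/
def ext (L : G.Sheet) (x : L.carrier) (v : V) (h : G.Near (L.proj x) v) : L.next.carrier :=
  Quot.mk _ ⟨(x, v), h⟩

@[simp] lemma proj_ext (L : G.Sheet) (x : L.carrier) (v : V) (h : G.Near (L.proj x) v) :
    L.next.proj (L.ext x v h) = v := rfl

/-- A point of a sheet as a point of the next sheet. -/
def incl (L : G.Sheet) (x : L.carrier) : L.next.carrier := L.ext x (L.proj x) Near.rfl

lemma exists_eq_ext (L : G.Sheet) (y : L.next.carrier) :
    ∃ x h, y = L.ext x (L.next.proj y) h := by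
  rcases y with ⟨⟨⟨b, v⟩, hv⟩⟩
  exact ⟨b, hv, rfl⟩

lemma ext_eq_ext (L : G.Sheet) {x y : L.carrier} (h : L.adj x y) {v : V}
    (hx : G.Near (L.proj x) v) (hy : G.Near (L.proj y) v) : L.ext x v hx = L.ext y v hy :=
  Quot.sound ⟨rfl, h⟩

lemma adj_ext (L : G.Sheet) {x : L.carrier} {v w : V} (hv : G.Near (L.proj x) v)
    (hw : G.Near (L.proj x) w) (h : G.Near v w) : L.next.adj (L.ext x v hv) (L.ext x w hw) :=
  ⟨x, v, w, hv, hw, rfl, rfl, h⟩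

/-- The two extensions of `x` are adjacent through `x`, which identifies their extensions by `w`.
This is the triviality of transport around triangles. -/
lemma ext_ext (L : G.Sheet) {x : L.carrier} {v w : V} (hv : G.Near (L.proj x) v)
    (hw : G.Near (L.proj x) w) (h : G.Near v w) :
    L.next.ext (L.ext x v hv) w h = L.next.incl (L.ext x w hw) :=
  L.next.ext_eq_ext (L.adj_ext hv hw h) h Near.rfl

/-- Adjacency of points projecting to vertices near `v`. -/
def Step (L : G.Sheet) (v : V) (x y : L.carrier) : Prop :=
  L.adj x y ∧ G.Near (L.proj x) v ∧ G.Near (L.proj y) v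

lemma Step.symm {L : G.Sheet} {v : V} {x y : L.carrier} (h : L.Step v x y) : L.Step v y x :=
  ⟨L.adj_symm h.1, h.2.2, h.2.1⟩

instance (L : G.Sheet) (v : V) : Std.Symm (L.Step v) := ⟨fun _ _ => Step.symm⟩

lemma chain_of_ext_eq (L : G.Sheet) {x y : L.carrier} {v : V} (hx : G.Near (L.proj x) v)
    (hy : G.Near (L.proj y) v) (h : L.ext x v hx = L.ext y v hy) :
    Relation.ReflTransGen (L.Step v) x y := by
  have key : ∀ p q : L.Extension, Relation.EqvGen (Extension.Rel L) p q → p.1.2 = q.1.2 ∧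
      Relation.ReflTransGen (L.Step p.1.2) p.1.1 q.1.1 := by
    intro p q h
    induction h with
    | rel p q h =>
      refine ⟨h.1, Relation.ReflTransGen.single ⟨h.2, p.2, ?_⟩⟩
      rw [h.1]
      exact q.2
    | refl p => exact ⟨rfl, Relation.ReflTransGen.refl⟩
    | symm p q _ ih =>
      refine ⟨ih.1.symm, ?_⟩
      rw [← ih.1]
      exact Relation.ReflTransGen.stdSymm.symm _ _ ih.2
    | trans p q r _ _ ih ih' =>
      refine ⟨ih.1.trans ih'.1, ih.2.trans ?_⟩
      rw [ih.1]
      exact ih'.2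
  exact (key _ _ (Quot.eqvGen_exact h)).2

/-- Every point together with finitely many adjacent points lies in a copy in the sheet of the unit
ball around a vertex of `P`. -/
def Dominated (L : G.Sheet) (P : Set V) : Prop :=
  ∀ (x : L.carrier) (F : Set L.carrier), F.Finite → (∀ y ∈ F, L.adj x y) →
    ∃ p ∈ P, ∃ s : V → L.carrier, (∀ g, G.Near p g → L.proj (s g) = g) ∧
      (∀ g g', G.Near p g → G.Near p g' → G.Near g g' → L.adj (s g) (s g')) ∧
      ∀ y ∈ insert x F, G.Near p (L.proj y) ∧ s (L.proj y) = y

variable {L : G.Sheet} {P : Set V}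

/-- The three points lie in one copy of a unit ball, where adjacency can be read off the
projections. -/
lemma Dominated.adj_of_near (hD : L.Dominated P) {x y z : L.carrier} (hx : L.adj z x)
    (hy : L.adj z y) (h : G.Near (L.proj x) (L.proj y)) : L.adj x y := by
  obtain ⟨p, -, s, -, hs, hs'⟩ := hD z {x, y} (by simp) (by
    rintro _ (rfl | rfl) <;> assumption)
  have h1 := hs' x (by simp)
  have h2 := hs' y (by simp)
  have h3 := hs _ _ h1.1 h2.1 h
  rwa [h1.2, h2.2] at h3

lemma Dominated.eq_of_proj_eq (hD : L.Dominated P) {x y z : L.carrier} (hx : L.adj z x)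
    (hy : L.adj z y) (h : L.proj x = L.proj y) : x = y := by
  obtain ⟨p, -, s, -, hs, hs'⟩ := hD z {x, y} (by simp) (by
    rintro _ (rfl | rfl) <;> assumption)
  rw [← (hs' x (by simp)).2, h, (hs' y (by simp)).2]

/-- Moves `a` along the path `a`, `e`, `d` without losing what holds for `T`. Clique-Hellyness at
the triangle of `v`, `e`, `d` gives `g`, whose lift replaces `e`; at the triangle of `a`, `g`, `v`
it gives `m`, whose lift is adjacent to `d` and to all points of `T`. -/
lemma Dominated.exists_adj_of_adj_adj (hD : L.Dominated P) (hc : G.IsFinitelyCliqueHelly) {v : V}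
    {T : Set (L.carrier × V)} (hT : T.Finite) {a e d : L.carrier} {w : V}
    (haT : ∀ q ∈ T, L.adj a q.1 ∧ G.Near (L.proj a) q.2 ∧ G.Near (L.proj q.1) v ∧ G.Near q.2 v)
    (hae : L.adj a e) (hed : L.adj e d) (hav : G.Near (L.proj a) v) (hev : G.Near (L.proj e) v)
    (hdv : G.Near (L.proj d) v) (hwd : G.Near w (L.proj d)) (hwv : G.Near w v) :
    ∃ b, G.Near (L.proj b) v ∧ L.adj b d ∧ G.Near (L.proj b) w ∧
      ∀ q ∈ T, L.adj b q.1 ∧ G.Near (L.proj b) q.2 := by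
  obtain ⟨p, -, s, hs1, hs2, hs3⟩ := hD e {a, d} (by simp) (by
    rintro _ (rfl | rfl)
    · exact L.adj_symm hae
    · exact hed)
  obtain ⟨hpe, hse⟩ := hs3 e (by simp)
  obtain ⟨hpa, hsa⟩ := hs3 a (by simp)
  obtain ⟨hpd, hsd⟩ := hs3 d (by simp)
  have hae' := L.near_of_adj hae
  have hed' := L.near_of_adj hed
  -- The centre `p` is included so that `g` lies in its unit ball and is lifted by `s`.
  obtain ⟨g, hg⟩ := hc.exists_near_triangle hev.symm hed' hdv.symm
    {v, L.proj e, L.proj d, L.proj a, w, p} (by simp) (by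
    rintro _ (rfl | rfl | rfl | rfl | rfl | rfl)
    · exact Or.inl ⟨Near.rfl, hev.symm⟩
    · exact Or.inl ⟨hev, Near.rfl⟩
    · exact Or.inr (Or.inr ⟨hdv, Near.rfl⟩)
    · exact Or.inl ⟨hav, hae'⟩
    · exact Or.inr (Or.inr ⟨hwv, hwd⟩)
    · exact Or.inr (Or.inl ⟨hpe, hpd⟩))
  have hpg : G.Near p g := (hg p (by simp)).symm
  have hgv := hg v (by simp)
  have hga := hg (L.proj a) (by simp)
  have hgd := hg (L.proj d) (by simp)
  have hgw := hg w (by simp)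
  have hsga : L.adj (s g) a := hsa ▸ hs2 g _ hpg hpa hga
  have hsgd : L.adj (s g) d := hsd ▸ hs2 g _ hpg hpd hgd
  have hfsg : L.proj (s g) = g := hs1 g hpg
  obtain ⟨r, -, t, ht1, ht2, ht3⟩ := hD a (insert (s g) (Prod.fst '' T))
    ((hT.image _).insert _) (by
    rintro _ (rfl | ⟨q, hq, rfl⟩)
    · exact L.adj_symm hsga
    · exact (haT q hq).1)
  obtain ⟨hra, hta⟩ := ht3 a (by simp)
  obtain ⟨hrg, htg⟩ := ht3 (s g) (by simp)
  rw [hfsg] at hrg htg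
  have hfr : L.proj (t r) = r := ht1 r Near.rfl
  have hgtr : L.adj (s g) (t r) := htg ▸ ht2 g r hrg Near.rfl hrg.symm
  -- The point `t r` is put into the second copy in order to compare the lifts `t m` and `t' m`:
  -- both are adjacent to it, hence equal.
  obtain ⟨r', -, t', ht1', ht2', ht3'⟩ := hD (s g) {a, d, t r} (by simp) (by
    rintro _ (rfl | rfl | rfl) <;> assumption)
  obtain ⟨hrg', htg'⟩ := ht3' (s g) (by simp)
  obtain ⟨hra', hta'⟩ := ht3' a (by simp)
  obtain ⟨hrd', htd'⟩ := ht3' d (by simp)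
  obtain ⟨hrr', htr'⟩ := ht3' (t r) (by simp)
  rw [hfsg] at hrg' htg'
  rw [hfr] at hrr' htr'
  obtain ⟨m, hm⟩ := hc.exists_near_triangle hav.symm hga.symm hgv.symm
    ({v, L.proj d, w, r, r'} ∪ ((fun q => L.proj q.1) '' T ∪ Prod.snd '' T))
    ((by simp : Set.Finite _).union ((hT.image _).union (hT.image _))) (by
    rintro _ ((rfl | rfl | rfl | rfl | rfl) | ⟨q, hq, rfl⟩ | ⟨q, hq, rfl⟩)
    · exact Or.inl ⟨Near.rfl, hav.symm⟩
    · exact Or.inr (Or.inr ⟨hdv, hgd.symm⟩)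
    · exact Or.inr (Or.inr ⟨hwv, hgw.symm⟩)
    · exact Or.inr (Or.inl ⟨hra, hrg⟩)
    · exact Or.inr (Or.inl ⟨hra', hrg'⟩)
    · exact Or.inl ⟨(haT q hq).2.2.1, (L.near_of_adj (haT q hq).1).symm⟩
    · exact Or.inl ⟨(haT q hq).2.2.2, (haT q hq).2.1.symm⟩)
  have hmr : G.Near r m := (hm r (by simp)).symm
  have hmr' : G.Near r' m := (hm r' (by simp)).symm
  have hft : L.proj (t m) = m := ht1 m hmr
  have htt : t m = t' m := by
    refine hD.eq_of_proj_eq (z := t r) (ht2 r m Near.rfl hmr hmr) ?_ ?_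
    · rw [← htr']
      exact ht2' r m hrr' hmr' hmr
    · rw [hft, ht1' m hmr']
  refine ⟨t m, ?_, ?_, ?_, fun q hq => ⟨?_, ?_⟩⟩
  · rw [hft]; exact hm v (by simp)
  · rw [htt, ← htd']
    exact ht2' m _ hmr' hrd' (hm _ (by simp))
  · rw [hft]; exact hm w (by simp)
  · obtain ⟨h1, h2⟩ := ht3 q.1 (Or.inr (Or.inr ⟨q, hq, rfl⟩))
    rw [← h2]
    exact ht2 m _ hmr h1 (hm _ (Or.inr (Or.inl ⟨q, hq, rfl⟩)))
  · rw [hft]; exact hm _ (Or.inr (Or.inr ⟨q, hq, rfl⟩))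

/-- Induction on `T`: a representative good for the earlier pairs is moved along the chain of
identifications to `q.1`. A last move, with `e = d = q.1` and `w = q.2`, makes it near `q.2` as
well. -/
lemma Dominated.exists_adj_of_ext_eq (hD : L.Dominated P) (hc : G.IsFinitelyCliqueHelly) {v : V}
    (x : L.next.carrier) (hxv : L.next.proj x = v) (T : Set (L.carrier × V)) (hT : T.Finite)
    (hTx : ∀ q ∈ T, G.Near (L.proj q.1) q.2 ∧ G.Near q.2 v ∧
      ∃ h : G.Near (L.proj q.1) v, L.ext q.1 v h = x) :
    ∃ b, G.Near (L.proj b) v ∧ ∀ q ∈ T, L.adj b q.1 ∧ G.Near (L.proj b) q.2 := by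
  obtain ⟨b₀, hb₀, hx⟩ := L.exists_eq_ext x
  rw [hxv] at hb₀
  simp only [hxv] at hx
  suffices ∃ b, G.Near (L.proj b) v ∧ Relation.ReflTransGen (L.Step v) b₀ b ∧
      ∀ q ∈ T, L.adj b q.1 ∧ G.Near (L.proj b) q.2 by
    obtain ⟨b, h1, -, h2⟩ := this
    exact ⟨b, h1, h2⟩
  induction T, hT using Set.Finite.induction_on with
  | empty => exact ⟨b₀, hb₀, Relation.ReflTransGen.refl, by simp⟩
  | @insert q T _ hT ih =>
    obtain ⟨a, hav, hba, haT⟩ := ih fun q hq => hTx q (Or.inr hq)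
    obtain ⟨hq1, hq2, hq3, hq4⟩ := hTx q (Or.inl rfl)
    have hTv : ∀ q ∈ T, G.Near (L.proj q.1) v ∧ G.Near q.2 v := fun q hq =>
      ⟨(hTx q (Or.inr hq)).2.2.1, (hTx q (Or.inr hq)).2.1⟩
    have haq : Relation.ReflTransGen (L.Step v) a q.1 :=
      (Relation.ReflTransGen.stdSymm.symm _ _ hba).trans
        (L.chain_of_ext_eq hb₀ hq3 (hx.symm.trans hq4.symm))
    have key : ∀ e, Relation.ReflTransGen (L.Step v) a e → ∃ b, G.Near (L.proj b) v ∧ L.adj b e ∧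
        ∀ q ∈ T, L.adj b q.1 ∧ G.Near (L.proj b) q.2 := by
      intro e he
      induction he with
      | refl => exact ⟨a, hav, L.adj_refl a, haT⟩
      | tail _ hed ih =>
        obtain ⟨b, h1, h2, h3⟩ := ih
        obtain ⟨b', h4, h5, -, h6⟩ := hD.exists_adj_of_adj_adj hc hT
          (fun q hq => ⟨(h3 q hq).1, (h3 q hq).2, hTv q hq⟩) h2 hed.1 h1 hed.2.1 hed.2.2
          Near.rfl hed.2.2
        exact ⟨b', h4, h5, h6⟩
    obtain ⟨b, h1, h2, h3⟩ := key q.1 haq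
    obtain ⟨b', h4, h5, h6, h7⟩ := hD.exists_adj_of_adj_adj hc hT
      (fun q hq => ⟨(h3 q hq).1, (h3 q hq).2, hTv q hq⟩) h2 (L.adj_refl _) h1 hq3 hq3 hq1.symm hq2
    refine ⟨b', h4, (hba.trans haq).tail ⟨L.adj_symm h5, hq3, h4⟩, ?_⟩
    rintro q' (rfl | hq')
    · exact ⟨h5, h6⟩
    · exact h7 q' hq'

/-- Every point adjacent to `x` extends some representative of `x`. A representative `b` adjacent to
all those involved yields all the points as its own extensions, and these form a copy of the unit
ball around the projection of `b`. -/
lemma Dominated.next (hD : L.Dominated P) (hc : G.IsFinitelyCliqueHelly) :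
    L.next.Dominated (Set.range L.proj) := by
  intro x F hF hxF
  have hF' : ∀ y ∈ insert x F, ∃ q : L.carrier × V, ∃ h : G.Near (L.proj q.1) q.2,
      y = L.ext q.1 q.2 h ∧ G.Near q.2 (L.next.proj x) ∧
      ∃ h : G.Near (L.proj q.1) (L.next.proj x), L.ext q.1 (L.next.proj x) h = x := by
    intro y hy
    have hxy : L.next.adj x y := by
      rcases hy with rfl | hy
      · exact L.next.adj_refl y
      · exact hxF y hy
    obtain ⟨b, v, w, hv, hw, rfl, rfl, h⟩ := hxy
    exact ⟨(b, w), hw, rfl, h.symm, hv, rfl⟩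
  have : Nonempty (L.carrier × V) := ⟨(hF' x (Or.inl rfl)).choose⟩
  choose! q hq1 hq2 hq3 hq4 hq5 using hF'
  obtain ⟨b, hb, hbq⟩ := hD.exists_adj_of_ext_eq hc x rfl (q '' insert x F)
    ((hF.insert x).image q) (by
      rintro _ ⟨y, hy, rfl⟩
      exact ⟨hq1 y hy, hq3 y hy, hq4 y hy, hq5 y hy⟩)
  classical
  refine ⟨L.proj b, ⟨b, rfl⟩, fun g => if h : G.Near (L.proj b) g then L.ext b g h else L.incl b,
    fun g hg => ?_, fun g g' hg hg' h => ?_, fun y hy => ?_⟩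
  · simp [hg]
  · simp only [hg, hg', dif_pos]
    exact L.adj_ext hg hg' h
  · obtain ⟨h1, h2⟩ := hbq _ ⟨y, hy, rfl⟩
    have h3 : L.next.proj y = (q y).2 := by
      conv_lhs => rw [hq2 y hy]
      rfl
    rw [h3]
    refine ⟨h2, ?_⟩
    simp only [h2, dif_pos]
    conv_rhs => rw [hq2 y hy]
    exact L.ext_eq_ext h1 _ _

lemma Dominated.adj_of_ext_eq (hD : L.Dominated P) (hc : G.IsFinitelyCliqueHelly)
    {x y : L.carrier} (h : G.Near (L.proj x) (L.proj y))
    (hxy : L.ext x (L.proj y) h = L.incl y) : L.adj x y := by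
  obtain ⟨b, hb, hbq⟩ := hD.exists_adj_of_ext_eq hc (L.incl y) rfl
    {(x, L.proj x), (y, L.proj y)} (by simp) (by
      rintro q (rfl | rfl)
      · exact ⟨Near.rfl, h, h, hxy⟩
      · exact ⟨Near.rfl, Near.rfl, Near.rfl, rfl⟩)
  exact hD.adj_of_near (hbq (x, L.proj x) (by simp)).1 (hbq (y, L.proj y) (by simp)).1 h

lemma Dominated.incl_injective (hD : L.Dominated P) (hc : G.IsFinitelyCliqueHelly) :
    Function.Injective L.incl := by
  intro x y hxy
  have h : L.proj x = L.proj y := congrArg L.next.proj hxy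
  have hadj : L.adj x y := by
    refine hD.adj_of_ext_eq hc (Or.inl h) ?_
    rw [← hxy]
    simp only [← h]
    rfl
  exact hD.eq_of_proj_eq (L.adj_refl x) hadj h

end Sheet

/-- The ball of radius `k + 1` around a lift of `u` in the universal cover. -/
def sheet (G : SimpleGraph V) (u : V) : ℕ → G.Sheet
  | 0 =>
    { carrier := {v // G.Near u v}
      proj := Subtype.val
      adj := fun x y => G.Near x.1 y.1
      adj_refl := fun _ => Near.rfl
      adj_symm := Near.symm
      near_of_adj := id }
  | k + 1 => (sheet G u k).next

lemma dist_proj_sheet_le (hG : G.Connected) (u : V) (k : ℕ) (x : (G.sheet u k).carrier) :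
    G.dist u ((G.sheet u k).proj x) ≤ k + 1 := by
  induction k with
  | zero => exact hG.near_iff.mp x.2
  | succ k ih =>
    obtain ⟨y, h, -⟩ := (G.sheet u k).exists_eq_ext x
    exact hG.dist_le_of_near (ih y) h

lemma exists_proj_sheet_eq (hG : G.Connected) (u : V) (k : ℕ) (v : V) (hv : G.dist u v ≤ k + 1) :
    ∃ x : (G.sheet u k).carrier, (G.sheet u k).proj x = v := by
  induction k generalizing v with
  | zero => exact ⟨⟨v, hG.near_iff.mpr hv⟩, rfl⟩
  | succ k ih =>
    obtain ⟨w, h1, h2⟩ := hG.exists_near_dist (u := v) (v := u) (r := k + 1) (by rwa [dist_comm])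
    rw [dist_comm] at h2
    obtain ⟨x, rfl⟩ := ih w h2
    exact ⟨(G.sheet u k).ext x v h1.symm, rfl⟩

/-- The centres of the copies are projections from the preceding sheet, which bounds their distance
from `u`. -/
lemma IsFinitelyCliqueHelly.dominated_sheet (hc : G.IsFinitelyCliqueHelly) (hG : G.Connected)
    (u : V) (k : ℕ) : (G.sheet u k).Dominated {p | G.dist u p ≤ k} := by
  induction k with
  | zero =>
    intro x F hF hxF
    classical
    refine ⟨u, by simp, fun g => if h : G.Near u g then ⟨g, h⟩ else x, fun g hg => ?_,
      fun g g' hg hg' h => ?_, fun y _ => ⟨y.2, ?_⟩⟩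
    · exact congrArg Subtype.val (dif_pos hg)
    · exact (congrArg₂ (G.sheet u 0).adj (dif_pos hg) (dif_pos hg')).mpr h
    · exact dif_pos y.2
  | succ k ih =>
    intro x F hF hxF
    obtain ⟨_, ⟨b, rfl⟩, h⟩ := ih.next hc x F hF hxF
    exact ⟨_, dist_proj_sheet_le hG u k b, h⟩

/-- If points of the sheets with the same projection are equal, then finite sets in balls of the
graph are dominated. -/
lemma IsFinitelyCliqueHelly.finitelyDominated (hc : G.IsFinitelyCliqueHelly) (hG : G.Connected)
    (u : V) (hinj : ∀ k, Function.Injective (G.sheet u k).proj) : G.FinitelyDominated u := by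
  intro k v F hF hv hFv
  have hD := hc.dominated_sheet hG u k
  obtain ⟨x, rfl⟩ := exists_proj_sheet_eq hG u k v hv
  have : Nonempty (G.sheet u k).carrier := ⟨x⟩
  choose! y hy using fun y hy => exists_proj_sheet_eq hG u k y (hFv y hy).2
  -- Points over near vertices are adjacent, since injectivity for the next sheet makes their
  -- extensions by the same vertex equal.
  obtain ⟨p, hp, s, -, -, hs⟩ := hD x (y '' F) (hF.image y) (by
    rintro _ ⟨z, hz, rfl⟩
    refine hD.adj_of_ext_eq hc ?_ (hinj (k + 1) rfl)
    rw [hy z hz]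
    exact (hFv z hz).1)
  refine ⟨p, hp, (hs x (by simp)).1, fun z hz => ?_⟩
  have := (hs (y z) (Or.inr ⟨z, hz, rfl⟩)).1
  rwa [hy z hz] at this

end SimpleGraph

/-! ### Sequential colimits of injections -/

section SequentialColimit

universe u

variable {H : ℕ → Type u} (i : ∀ k, H k → H (k + 1))

/-- Points of a sequence of types are identified with their images under the transition maps. -/
inductive SeqRel : (Σ k, H k) → (Σ k, H k) → Prop
  | step (k : ℕ) (x : H k) : SeqRel ⟨k, x⟩ ⟨k + 1, i k x⟩

lemma SeqRel.exists_eq {p q : Σ k, H k} (h : Relation.EqvGen (SeqRel i) p q) :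
    ∃ (m : ℕ) (hp : p.1 ≤ m) (hq : q.1 ≤ m),
      Nat.leRecOn (C := H) hp (fun {k} => i k) p.2 =
        Nat.leRecOn (C := H) hq (fun {k} => i k) q.2 := by
  induction h with
  | rel p q h =>
    obtain ⟨k, x⟩ := h
    exact ⟨k + 1, Nat.le_succ k, le_rfl, by rw [Nat.leRecOn_succ', Nat.leRecOn_self]⟩
  | refl p => exact ⟨p.1, le_rfl, le_rfl, rfl⟩
  | symm p q _ ih =>
    obtain ⟨m, hp, hq, h⟩ := ih
    exact ⟨m, hq, hp, h.symm⟩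
  | trans p q r _ _ ih ih' =>
    obtain ⟨m, hp, hq, h⟩ := ih
    obtain ⟨m', hq', hr, h'⟩ := ih'
    refine ⟨max m m', hp.trans (le_max_left _ _), hr.trans (le_max_right _ _), ?_⟩
    rw [Nat.leRecOn_trans hp (le_max_left m m'), Nat.leRecOn_trans hr (le_max_right m m'), h, ← h',
      ← Nat.leRecOn_trans, ← Nat.leRecOn_trans]

lemma SeqRel.mk_injective (hi : ∀ k, Function.Injective (i k)) (k : ℕ) :
    Function.Injective fun x : H k => Quot.mk (SeqRel i) ⟨k, x⟩ := by
  intro x y hxy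
  obtain ⟨m, hp, hq, h⟩ := SeqRel.exists_eq i (Quot.eqvGen_exact hxy)
  exact Nat.leRecOn_injective (C := H) hp (fun {k} => i k) hi h

end SequentialColimit

/-! ### Cocycles on the edges and their triviality -/

namespace SimpleGraph

universe u

variable {V : Type u} {G : SimpleGraph V}

/-- Every group-valued cocycle on the clique complex of `G` is a coboundary. -/
def CocyclesTrivial (G : SimpleGraph V) : Prop :=
  ∀ (Γ : Type u) [Group Γ] (c : V → V → Γ),
    (∀ a b d, G.Near a b → G.Near b d → G.Near a d → c a b * c b d = c a d) →
    ∃ f : V → Γ, ∀ a b, G.Near a b → c a b = (f a)⁻¹ * f b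

/-- A system of sets over the vertices of `G`, with transport along edges that is trivial around
triangles, has a global labelling that is invariant under transport. -/
lemma CocyclesTrivial.exists_labelling (h : G.CocyclesTrivial) (hG : G.Connected) {X : Type u}
    (π : X → V) (E : X → V → X) (hE : ∀ x b, G.Near (π x) b → π (E x b) = b)
    (hEπ : ∀ x, E x (π x) = x)
    (hEE : ∀ x b d, G.Near (π x) b → G.Near b d → G.Near (π x) d → E (E x b) d = E x d) :
    ∃ (T : Type u) (l : X → T), (∀ x b, G.Near (π x) b → l (E x b) = l x) ∧
      ∀ x y, π x = π y → l x = l y → x = y := by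
  classical
  let Φ : V → Type u := fun a => {x // π x = a}
  let σ : ∀ a b, G.Near a b → Φ a → Φ b := fun a b hab x => ⟨E x.1 b, hE _ _ (x.2.symm ▸ hab)⟩
  have hσσ : ∀ a b d (hab : G.Near a b) (hbd : G.Near b d) (had : G.Near a d) x,
      σ b d hbd (σ a b hab x) = σ a d had x := by
    rintro a b d hab hbd had ⟨x, rfl⟩
    exact Subtype.ext (hEE x b d hab hbd had)
  have hσid : ∀ a (haa : G.Near a a) x, σ a a haa x = x := by
    rintro a haa ⟨x, rfl⟩
    exact Subtype.ext (hEπ x)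
  let eσ : ∀ a b, G.Near a b → Φ a ≃ Φ b := fun a b hab =>
    { toFun := σ a b hab
      invFun := σ b a hab.symm
      left_inv := fun x => (hσσ a b a hab hab.symm Near.rfl x).trans (hσid a Near.rfl x)
      right_inv := fun x => (hσσ b a b hab.symm hab Near.rfl x).trans (hσid b Near.rfl x) }
  obtain ⟨u⟩ := hG.nonempty
  have he : ∀ a, Nonempty (Φ a ≃ Φ u) := by
    intro a
    obtain ⟨p⟩ := hG a u
    induction p with
    | nil => exact ⟨Equiv.refl _⟩
    | cons hab _ ih => exact ⟨(eσ _ _ hab.near).trans ih.some⟩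
  let e : ∀ a, Φ a ≃ Φ u := fun a => (he a).some
  -- Transport read in the reference fibre over `u` is a cocycle of permutations; a potential for it
  -- makes the labels constant under transport.
  let c : V → V → Equiv.Perm (Φ u) := fun a b =>
    if hab : G.Near a b then (e b).symm.trans ((eσ b a hab.symm).trans (e a)) else 1
  obtain ⟨f, hf⟩ := h (Equiv.Perm (Φ u)) c (by
    intro a b d hab hbd had
    ext1 x
    simp only [c, hab, hbd, had, dif_pos, Equiv.Perm.mul_apply, Equiv.trans_apply,
      Equiv.symm_apply_apply]
    exact congrArg (e a) (hσσ d b a hbd.symm hab.symm had.symm _))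
  have hl : ∀ a b (hab : G.Near a b) (x : Φ b), f a (e a (σ b a hab.symm x)) = f b (e b x) := by
    intro a b hab x
    have h1 := congrArg (fun g : Equiv.Perm (Φ u) => f a (g (e b x))) (hf a b hab)
    simpa [c, hab, eσ] using h1
  refine ⟨Φ u, fun x => f (π x) (e (π x) ⟨x, rfl⟩), fun x b hb => ?_, fun x y hxy hl => ?_⟩
  · have h1 := hl b (π x) hb.symm ⟨x, rfl⟩
    refine Eq.trans ?_ h1
    have h2 : ∀ (a : V) (y : Φ a), f (π y.1) (e (π y.1) ⟨y.1, rfl⟩) = f a (e a y) := by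
      rintro a ⟨y, rfl⟩
      rfl
    exact h2 b (σ (π x) b hb ⟨x, rfl⟩)
  · have h2 : ∀ (a : V) (hya : π y = a), f (π y) (e (π y) ⟨y, rfl⟩) = f a (e a ⟨y, hya⟩) := by
      rintro _ rfl
      rfl
    replace hl := hl.trans (h2 (π x) hxy.symm)
    exact congrArg Subtype.val ((e (π x)).injective ((f (π x)).injective hl))

/-- In the colimit of the sheets every point is reached from the base point by transport, so all
labels agree. Labels separate points over the same vertex, and the sheets embed in the colimit. -/
lemma CocyclesTrivial.proj_sheet_injective (h : G.CocyclesTrivial) (hG : G.Connected)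
    (hc : G.IsFinitelyCliqueHelly) (u : V) (k : ℕ) :
    Function.Injective (G.sheet u k).proj := by
  classical
  let i : ∀ k, (G.sheet u k).carrier → (G.sheet u (k + 1)).carrier := fun k =>
    (G.sheet u k).incl
  let X := Quot (SeqRel (H := fun k => (G.sheet u k).carrier) i)
  let j : ∀ k, (G.sheet u k).carrier → X := fun k x => Quot.mk _ ⟨k, x⟩
  have hj : ∀ k x, j (k + 1) ((G.sheet u k).incl x) = j k x := fun k x =>
    (Quot.sound (SeqRel.step (i := i) k x)).symm
  let π : X → V := Quot.lift (fun p => (G.sheet u p.1).proj p.2) (by rintro _ _ ⟨k, x⟩; rfl)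
  let E₀ : (Σ k, (G.sheet u k).carrier) → V → X := fun p b =>
    if hb : G.Near ((G.sheet u p.1).proj p.2) b then j (p.1 + 1) ((G.sheet u p.1).ext p.2 b hb)
    else j p.1 p.2
  let E : X → V → X := fun x b => Quot.lift (fun p => E₀ p b) (by
    rintro _ _ ⟨k, x⟩
    by_cases hb : G.Near ((G.sheet u k).proj x) b
    · have h1 : E₀ ⟨k, x⟩ b = j (k + 1) ((G.sheet u k).ext x b hb) := dif_pos hb
      have h2 : E₀ ⟨k + 1, (G.sheet u k).incl x⟩ b =
        j (k + 2) ((G.sheet u (k + 1)).ext ((G.sheet u k).incl x) b hb) := dif_pos hb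
      refine h1.trans (Eq.trans ?_ h2.symm)
      exact (hj (k + 1) _).symm.trans
        (congrArg (j (k + 2)) ((G.sheet u k).ext_ext Near.rfl hb hb).symm)
    · have h1 : E₀ ⟨k, x⟩ b = j k x := dif_neg hb
      have h2 : E₀ ⟨k + 1, (G.sheet u k).incl x⟩ b = j (k + 1) ((G.sheet u k).incl x) := dif_neg hb
      exact h1.trans ((hj k x).symm.trans h2.symm)) x
  have hEj : ∀ k x b (hb : G.Near ((G.sheet u k).proj x) b),
      E (j k x) b = j (k + 1) ((G.sheet u k).ext x b hb) := fun k x b hb => dif_pos hb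
  obtain ⟨T, l, hl1, hl2⟩ := h.exists_labelling hG π E
    (by
      rintro ⟨k, x⟩ b hb
      exact congrArg π (hEj k x b hb))
    (by
      rintro ⟨k, x⟩
      exact (hEj k x _ Near.rfl).trans (hj k x))
    (by
      rintro ⟨k, x⟩ b d hb hbd hd
      change E (E (j k x) b) d = E (j k x) d
      rw [hEj k x b hb, hEj k x d hd]
      exact (hEj (k + 1) ((G.sheet u k).ext x b hb) d hbd).trans
        ((congrArg (j (k + 2)) ((G.sheet u k).ext_ext hb hd hbd)).trans (hj (k + 1) _)))
  let o : (G.sheet u 0).carrier := ⟨u, Near.rfl⟩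
  have hconst : ∀ k x, l (j k x) = l (j 0 o) := by
    intro k
    induction k with
    | zero =>
      intro x
      have hx : G.Near ((G.sheet u 0).proj o) ((G.sheet u 0).proj x) := x.2
      rw [← hl1 (j 0 o) ((G.sheet u 0).proj x) hx, hEj 0 o _ hx, ← hj]
      exact congrArg (fun y => l (j 1 y))
        ((G.sheet u 0).ext_eq_ext (x := o) hx hx Near.rfl).symm
    | succ k ih =>
      intro x
      obtain ⟨y, hy, hxy⟩ := (G.sheet u k).exists_eq_ext x
      rw [← ih y, ← hl1 (j k y) _ hy, hEj k y _ hy]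
      exact congrArg (fun y => l (j (k + 1) y)) hxy
  intro x y hxy
  refine SeqRel.mk_injective (H := fun k => (G.sheet u k).carrier) i
    (fun k => (hc.dominated_sheet hG u k).incl_injective hc) k ?_
  exact hl2 (j k x) (j k y) hxy ((hconst k x).trans (hconst k y).symm)

lemma IsFinitelyCliqueHelly.isFinitelyHelly (hc : G.IsFinitelyCliqueHelly) (hG : G.Connected)
    (h : G.CocyclesTrivial) : G.IsFinitelyHelly :=
  isFinitelyHelly_of_finitelyDominated hG fun u =>
    hc.finitelyDominated hG u (h.proj_sheet_injective hG hc u)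

/-- Cocycles are coboundaries if the vertices can be ranked so that any two neighbours of a vertex
of at most its rank have a common neighbour of smaller rank. -/
lemma cocyclesTrivial_of_rank {α : Type*} [LinearOrder α] [WellFoundedLT α] (ρ : V → α) (u : V)
    (hu : ∀ v, v ≠ u → ρ u < ρ v)
    (h : ∀ v, v ≠ u → ∀ a b, G.Near a v → G.Near b v → ρ a ≤ ρ v → ρ b ≤ ρ v →
      ∃ p, ρ p < ρ v ∧ G.Near p v ∧ G.Near p a ∧ G.Near p b) : G.CocyclesTrivial := by
  intro Γ _ c hc
  classical
  have h0 : ∀ v, v ≠ u → ∃ p, ρ p < ρ v ∧ G.Near p v := by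
    intro v hv
    obtain ⟨p, h1, h2, -⟩ := h v hv v v Near.rfl Near.rfl le_rfl le_rfl
    exact ⟨p, h1, h2⟩
  have : Nonempty V := ⟨u⟩
  choose! q hq1 hq2 using h0
  have hwf : WellFounded (InvImage (· < ·) ρ) := InvImage.wf ρ wellFounded_lt
  let f : V → Γ := hwf.fix fun v ih => if hv : v = u then 1 else ih (q v) (hq1 v hv) * c (q v) v
  have hf : ∀ v, v ≠ u → f v = f (q v) * c (q v) v := by
    intro v hv
    change hwf.fix _ v = _
    rw [hwf.fix_eq, dif_neg hv]
  have hc1 : ∀ a, c a a = 1 := fun a => by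
    simpa using hc a a a Near.rfl Near.rfl Near.rfl
  have hcc : ∀ a b, G.Near a b → c a b * c b a = 1 := fun a b hab => by
    rw [hc a b a hab hab.symm Near.rfl, hc1]
  have key : ∀ v w, G.Near w v → ρ w ≤ ρ v → f w * c w v = f v := by
    intro v
    induction v using hwf.induction with
    | _ v ih =>
    have hlow : ∀ x y, ρ x < ρ v → ρ y < ρ v → G.Near x y → f x * c x y = f y := by
      intro x y hx hy hxy
      rcases le_total (ρ x) (ρ y) with hle | hle
      · exact ih y hy x hxy hle
      · rw [← ih x hx y hxy.symm hle, mul_assoc, hcc y x hxy.symm, mul_one]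
    -- The descents from `w` to `x` and to `q w` are compared through a lower vertex near both. All
    -- `w` of the rank of `v` are needed, because an edge within one rank is handled by descending
    -- from both ends.
    have hstep : ∀ w x, ρ w = ρ v → G.Near x w → ρ x < ρ w → f x * c x w = f w := by
      intro w x hw hxw hx
      have hwu : w ≠ u := by
        rintro rfl
        have : x ≠ w := by rintro rfl; exact lt_irrefl _ hx
        exact lt_asymm hx (hu x this)
      obtain ⟨p, hp, hpw, hpx, hpq⟩ := h w hwu x (q w) hxw (hq2 w hwu) hx.le (hq1 w hwu).le
      rw [hf w hwu, ← hlow p x (hw ▸ hp) (hw ▸ hx) hpx,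
        ← hlow p (q w) (hw ▸ hp) (hw ▸ hq1 w hwu) hpq, mul_assoc, mul_assoc,
        hc _ _ _ hpx hxw hpw, hc _ _ _ hpq (hq2 w hwu) hpw]
    intro w hwv hle
    by_cases hv : v = u
    · subst hv
      have : w = v := by
        by_contra hne
        exact absurd hle (not_le_of_gt (hu w hne))
      rw [this, hc1, mul_one]
    rcases hle.lt_or_eq with hlt | heq
    · exact hstep v w rfl hwv hlt
    · obtain ⟨p, hp, hpv, hpw, -⟩ := h v hv w w hwv hwv hle hle
      rw [← hstep v p rfl hpv hp, ← hstep w p heq hpw (heq ▸ hp), mul_assoc,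
        hc _ _ _ hpw hwv hpv]
  refine ⟨f, fun a b hab => ?_⟩
  rcases le_total (ρ a) (ρ b) with hle | hle
  · rw [← key b a hab hle, inv_mul_cancel_left]
  · rw [← key a b hab.symm hle, mul_inv_rev, inv_mul_cancel_right, eq_inv_iff_mul_eq_one,
      hcc _ _ hab]

lemma IsDismantlable.cocyclesTrivial (h : G.IsDismantlable) (hG : G.Connected) :
    G.CocyclesTrivial := by
  classical
  obtain ⟨r, hr, h⟩ := h
  let _ : LinearOrder V := linearOrderOfSTO r
  have hwf : WellFoundedLT V := ⟨hr.wf⟩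
  have hne : (Set.univ : Set V).Nonempty := ⟨hG.nonempty.some, trivial⟩
  obtain ⟨u, -, hu⟩ := hr.wf.has_min Set.univ hne
  have hu' : ∀ v, v ≠ u → r u v := by
    intro v hv
    rcases trichotomous_of r u v with h | h | h
    · exact h
    · exact absurd h.symm hv
    · exact absurd h (hu v trivial)
  refine cocyclesTrivial_of_rank (α := V) id u hu' ?_
  intro v hv a b hav hbv ha hb
  obtain ⟨w, hwv, hvw, hw⟩ := h v ⟨u, hu' v hv⟩
  have key : ∀ x, G.Near x v → x ≤ v → G.Near w x := by
    intro x hxv hx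
    have h1 : x = v ∨ r x v := hx.eq_or_lt
    have h2 : x = v ∨ G.Adj v x := hxv.imp id Adj.symm
    exact (hw x h1 h2).imp Eq.symm id
  exact ⟨w, hwv, hvw.symm.near, key a hav ha, key b hbv hb⟩

lemma IsFinitelyHelly.cocyclesTrivial (h : G.IsFinitelyHelly) (hG : G.Connected) :
    G.CocyclesTrivial := by
  obtain ⟨u⟩ := hG.nonempty
  refine cocyclesTrivial_of_rank (fun v => G.dist u v) u (fun v hv => ?_) ?_
  · simpa using hG.pos_dist_of_ne hv.symm
  intro v hv a b hav hbv ha hb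
  obtain ⟨k, hk⟩ := Nat.exists_eq_succ_of_ne_zero (hG.pos_dist_of_ne hv.symm).ne'
  obtain ⟨p, hp, hpv, hpF⟩ := h.finitelyDominated hG u k v {a, b} (by simp) hk.le (by
    rintro y (rfl | rfl)
    · exact ⟨hav.symm, by omega⟩
    · exact ⟨hbv.symm, by omega⟩)
  exact ⟨p, by omega, hpv, hpF a (by simp), hpF b (by simp)⟩

end SimpleGraph

/-! ### The weak topology, segments and open stars -/

namespace AbstractSimplicialComplex

open scoped unitInterval

universe u

variable {V : Type u} {K : AbstractSimplicialComplex V} {s : Finset V}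

/-- The barycentric coordinates of a point. -/
def Realization.weights (x : K.Realization) : V →₀ ℝ := x.1

lemma Realization.weights_nonneg (x : K.Realization) (v : V) : 0 ≤ x.weights v := x.2.1 v

lemma Realization.support_mem (x : K.Realization) : x.weights.support ∈ K.faces := x.2.2.1

lemma Realization.sum_weights (x : K.Realization) : (x.weights.sum fun _ a => a) = 1 := x.2.2.2

lemma Realization.ext {x y : K.Realization} (h : ∀ v, x.weights v = y.weights v) : x = y :=
  Subtype.ext (Finsupp.ext h)

/-- A point of the realization as a point of a closed simplex. -/
def ClosedSimplex.of (x : K.Realization) (hx : x.weights.support ⊆ s) : K.ClosedSimplex s := ⟨x, hx⟩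

lemma ClosedSimplex.support_incl (x : K.ClosedSimplex s) : x.incl.weights.support ⊆ s := x.2

lemma isOpen_realization_iff {U : Set K.Realization} :
    IsOpen U ↔ ∀ s ∈ K.faces, IsOpen ((ClosedSimplex.incl : K.ClosedSimplex s → _) ⁻¹' U) := by
  refine (isOpen_iSup_iff (t := fun s : K.faces => TopologicalSpace.coinduced
    (ClosedSimplex.incl : K.ClosedSimplex s.1 → K.Realization) inferInstance)).trans ?_
  simp only [isOpen_coinduced, Subtype.forall]

lemma continuous_incl (hs : s ∈ K.faces) :
    Continuous (ClosedSimplex.incl : K.ClosedSimplex s → K.Realization) :=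
  continuous_def.mpr fun _ hU => isOpen_realization_iff.mp hU s hs

lemma continuous_closedSimplex_coord (v : V) :
    Continuous fun x : K.ClosedSimplex s => x.incl.weights v :=
  (continuous_apply v).comp continuous_induced_dom

lemma continuous_to_closedSimplex {Y : Type*} [TopologicalSpace Y] {f : Y → K.ClosedSimplex s}
    (h : ∀ v, Continuous fun y => (f y).incl.weights v) : Continuous f :=
  continuous_induced_rng.mpr (continuous_pi h)

/-- Continuity of a map on an open subset of the realization can be tested on simplices. -/
lemma continuous_of_isOpen {U : Set K.Realization} (hU : IsOpen U) {Y : Type*}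
    [TopologicalSpace Y] (f : U → Y) (h : ∀ s ∈ K.faces,
      Continuous fun x : {x : K.ClosedSimplex s // x.incl ∈ U} => f ⟨x.1.incl, x.2⟩) :
    Continuous f := by
  refine continuous_def.mpr fun W hW => ?_
  rw [hU.isOpenEmbedding_subtypeVal.isOpen_iff_image_isOpen, isOpen_realization_iff]
  intro s hs
  have h1 : IsOpen {x : K.ClosedSimplex s | x.incl ∈ U} := hU.preimage (continuous_incl hs)
  have h2 := h1.isOpenMap_subtype_val _ (hW.preimage (h s hs))
  convert h2 using 1
  ext x
  simp only [Set.mem_preimage, Set.mem_image, Subtype.exists, exists_and_right, exists_eq_right]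
  exact Iff.rfl

lemma continuous_realization {Y : Type*} [TopologicalSpace Y] (f : K.Realization → Y)
    (h : ∀ s ∈ K.faces, Continuous fun x : K.ClosedSimplex s => f x.incl) : Continuous f :=
  continuous_def.mpr fun _ hW => isOpen_realization_iff.mpr fun s hs => hW.preimage (h s hs)

/-- After currying, a map to `C(I, Y)` can be tested on simplices; since `I` is locally compact,
continuity survives uncurrying. -/
lemma continuous_realization_prod {Y : Type*} [TopologicalSpace Y] (f : K.Realization × I → Y)
    (h : ∀ s ∈ K.faces, Continuous fun p : K.ClosedSimplex s × I => f (p.1.incl, p.2)) :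
    Continuous f := by
  have hx : ∀ x : K.Realization, Continuous fun t => f (x, t) := by
    intro x
    exact (h x.weights.support x.support_mem).comp
      (continuous_const (y := ClosedSimplex.of x subset_rfl) |>.prodMk
        continuous_id)
  let g : K.Realization → C(I, Y) := fun x => ⟨fun t => f (x, t), hx x⟩
  have hg : Continuous g := continuous_realization g fun s hs =>
    ContinuousMap.continuous_of_continuous_uncurry _ (h s hs)
  exact ContinuousMap.continuous_uncurry_of_continuous ⟨g, hg⟩

lemma continuous_coord (v : V) : Continuous fun x : K.Realization => x.weights v :=
  continuous_realization _ fun _ _ => continuous_closedSimplex_coord v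

/-- The open star of a vertex. -/
def openStar (K : AbstractSimplicialComplex V) (v : V) : Set K.Realization := {x | x.weights v ≠ 0}

lemma isOpen_openStar (v : V) : IsOpen (K.openStar v) :=
  isOpen_ne.preimage (continuous_coord v)

lemma Realization.support_nonempty (x : K.Realization) : x.weights.support.Nonempty :=
  (K.isRelLowerSet_faces x.support_mem).1

lemma mem_faces_of_subset (hs : s ∈ K.faces) {t : Finset V} (ht : t ⊆ s) (hne : t.Nonempty) :
    t ∈ K.faces :=
  (K.isRelLowerSet_faces hs).2 ht hne

/-- A point of a simplex with given barycentric coordinates. -/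
def ClosedSimplex.ofCoords (hs : s ∈ K.faces) (w : V →₀ ℝ) (h0 : ∀ v, 0 ≤ w v)
    (hw : w.support ⊆ s) (h1 : (w.sum fun _ a => a) = 1) : K.ClosedSimplex s :=
  ⟨⟨w, h0, mem_faces_of_subset hs hw (by
    rw [Finsupp.support_nonempty_iff]
    rintro rfl
    simp at h1), h1⟩, hw⟩

/-- The point dividing the segment between two points of a simplex. -/
noncomputable def ClosedSimplex.lerp (hs : s ∈ K.faces) (x y : K.ClosedSimplex s) (t : I) :
    K.ClosedSimplex s :=
  .ofCoords hs ((1 - t : ℝ) • x.incl.weights + (t : ℝ) • y.incl.weights)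
    (fun v => by
      have h1 := x.incl.weights_nonneg v
      have h2 := y.incl.weights_nonneg v
      have h3 := t.2.1
      have h4 := sub_nonneg.mpr t.2.2
      simp only [Finsupp.add_apply, Finsupp.smul_apply, smul_eq_mul]
      positivity)
    (by
      classical
      refine Finsupp.support_add.trans (Finset.union_subset ?_ ?_)
      · exact Finsupp.support_smul.trans x.support_incl
      · exact Finsupp.support_smul.trans y.support_incl)
    (by
      rw [Finsupp.sum_add_index' (by simp) (by simp), Finsupp.sum_smul_index' (by simp),
        Finsupp.sum_smul_index' (by simp)]
      simp only [smul_eq_mul, ← Finsupp.mul_sum]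
      rw [x.incl.sum_weights, y.incl.sum_weights]
      ring)

lemma ClosedSimplex.lerp_apply (hs : s ∈ K.faces) (x y : K.ClosedSimplex s) (t : I) (v : V) :
    (ClosedSimplex.lerp hs x y t).incl.weights v = (1 - t) * x.incl.weights v + t * y.incl.weights v := rfl

lemma ClosedSimplex.ext {x y : K.ClosedSimplex s} (h : ∀ v, x.incl.weights v = y.incl.weights v) : x = y :=
  Subtype.ext (Subtype.ext (Finsupp.ext h))

lemma ClosedSimplex.lerp_zero (hs : s ∈ K.faces) (x y : K.ClosedSimplex s) :
    ClosedSimplex.lerp hs x y 0 = x :=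
  ClosedSimplex.ext fun v => by simp [lerp_apply]

lemma ClosedSimplex.lerp_one (hs : s ∈ K.faces) (x y : K.ClosedSimplex s) :
    ClosedSimplex.lerp hs x y 1 = y :=
  ClosedSimplex.ext fun v => by simp [lerp_apply]

lemma continuous_lerp (hs : s ∈ K.faces) {Y : Type*} [TopologicalSpace Y]
    {f g : Y → K.ClosedSimplex s} {t : Y → I} (hf : Continuous f) (hg : Continuous g)
    (ht : Continuous t) : Continuous fun y => ClosedSimplex.lerp hs (f y) (g y) (t y) := by
  refine continuous_to_closedSimplex fun v => ?_
  simp only [ClosedSimplex.lerp_apply]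
  have h1 := (continuous_closedSimplex_coord v).comp hf
  have h2 := (continuous_closedSimplex_coord v).comp hg
  have h3 : Continuous fun y => (t y : ℝ) := continuous_subtype_val.comp ht
  exact ((continuous_const.sub h3).mul h1).add (h3.mul h2)

/-- A vertex as a point of the realization. -/
noncomputable def vertexPoint (K : AbstractSimplicialComplex V) (v : V) : K.Realization :=
  ⟨Finsupp.single v 1, fun w => by
    classical
    rw [Finsupp.single_apply]
    split_ifs <;> norm_num, by
    rw [Finsupp.support_single v one_ne_zero]
    exact K.singleton_mem v, by simp⟩

lemma support_vertexPoint (v : V) : (K.vertexPoint v).weights.support = {v} :=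
  Finsupp.support_single v one_ne_zero

lemma contractibleSpace_closedSimplex (hs : s ∈ K.faces) :
    ContractibleSpace (K.ClosedSimplex s) := by
  obtain ⟨v, hv⟩ := (K.isRelLowerSet_faces hs).1
  let p : K.ClosedSimplex s := ClosedSimplex.of (K.vertexPoint v) (by
    rw [support_vertexPoint]
    exact Finset.singleton_subset_iff.mpr hv)
  rw [contractible_iff_id_nullhomotopic]
  refine ⟨p, ⟨⟨⟨fun q => ClosedSimplex.lerp hs q.2 p q.1, ?_⟩, fun x => ?_, fun x => ?_⟩⟩⟩
  · exact continuous_lerp hs continuous_snd continuous_const continuous_fst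
  · exact ClosedSimplex.lerp_zero hs x p
  · exact ClosedSimplex.lerp_one hs x p

/-- Two points of the realization lie in a common simplex. -/
def Joinable (x y : K.Realization) : Prop :=
  ∃ s ∈ K.faces, x.weights.support ⊆ s ∧ y.weights.support ⊆ s

lemma Joinable.symm {x y : K.Realization} (h : Joinable x y) : Joinable y x :=
  let ⟨s, hs, hx, hy⟩ := h
  ⟨s, hs, hy, hx⟩

/-- The segment between two points of a simplex, as a path in the simplex. -/
noncomputable def ClosedSimplex.segment (hs : s ∈ K.faces) (x y : K.ClosedSimplex s) :
    Path x y where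
  toFun t := ClosedSimplex.lerp hs x y t
  continuous_toFun := continuous_lerp hs continuous_const continuous_const continuous_id
  source' := ClosedSimplex.lerp_zero hs x y
  target' := ClosedSimplex.lerp_one hs x y

/-- The segment between two points of a simplex, as a path in the realization. -/
noncomputable def segment {x y : K.Realization} (h : Joinable x y) : Path x y :=
  (ClosedSimplex.segment h.choose_spec.1 (.of x h.choose_spec.2.1) (.of y h.choose_spec.2.2)).map
    (continuous_incl h.choose_spec.1)

lemma segment_apply {x y : K.Realization} (h : Joinable x y) (t : I) (v : V) :
    (segment h t).weights v = (1 - t) * x.weights v + t * y.weights v := rfl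

lemma segment_eq_map {x y : K.Realization} (h : Joinable x y) (hs : s ∈ K.faces)
    (hx : x.weights.support ⊆ s) (hy : y.weights.support ⊆ s) :
    segment h = (ClosedSimplex.segment hs (.of x hx) (.of y hy)).map
      (continuous_incl hs) := by
  ext t
  rfl

open CategoryTheory

/-- The class of a path in the fundamental groupoid. -/
def pathClass {X : Type*} [TopologicalSpace X] {x y : X} (p : Path x y) :
    FundamentalGroupoid.mk x ⟶ FundamentalGroupoid.mk y :=
  FundamentalGroupoid.fromPath (Path.Homotopic.Quotient.mk p)

lemma pathClass_eq {X : Type*} [TopologicalSpace X] {x y : X} {p q : Path x y}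
    (h : p.Homotopic q) : pathClass p = pathClass q :=
  (FundamentalGroupoid.fromPath_eq_iff_homotopic p q).mpr h

lemma pathClass_trans {X : Type*} [TopologicalSpace X] {x y z : X} (p : Path x y) (q : Path y z) :
    pathClass (p.trans q) = pathClass p ≫ pathClass q := rfl

lemma pathClass_segment_comp {x y z : K.Realization} (hxy : Joinable x y) (hyz : Joinable y z)
    (hxz : Joinable x z) (hs : s ∈ K.faces) (hx : x.weights.support ⊆ s) (hy : y.weights.support ⊆ s)
    (hz : z.weights.support ⊆ s) :
    pathClass (segment hxy) ≫ pathClass (segment hyz) = pathClass (segment hxz) := by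
  have := contractibleSpace_closedSimplex hs
  rw [← pathClass_trans, segment_eq_map hxy hs hx hy, segment_eq_map hyz hs hy hz,
    segment_eq_map hxz hs hx hz]
  refine Eq.trans (congrArg pathClass (Path.map_trans (ClosedSimplex.segment hs (.of x hx)
    (.of y hy)) (ClosedSimplex.segment hs (.of y hy) (.of z hz)) (continuous_incl hs)).symm) ?_
  exact pathClass_eq ((SimplyConnectedSpace.paths_homotopic _ _).map ⟨_, continuous_incl hs⟩)

lemma joinable_vertexPoint {x : K.Realization} {v : V} (hv : x ∈ K.openStar v) :
    Joinable x (K.vertexPoint v) :=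
  ⟨x.weights.support, x.support_mem, subset_rfl, by
    rw [support_vertexPoint, Finset.singleton_subset_iff, Finsupp.mem_support_iff]
    exact hv⟩

lemma vertexPoint_mem_openStar (v : V) : K.vertexPoint v ∈ K.openStar v := by
  change (Finsupp.single v (1 : ℝ)) v ≠ 0
  simp

lemma segment_mem_openStar {x : K.Realization} {v : V} (hv : x ∈ K.openStar v) (t : I) :
    segment (joinable_vertexPoint hv) t ∈ K.openStar v := by
  change (segment (joinable_vertexPoint hv) t).weights v ≠ 0
  rw [segment_apply]
  have h1 : 0 < x.weights v := lt_of_le_of_ne (x.weights_nonneg v) (Ne.symm hv)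
  have h2 : (K.vertexPoint v).weights v = 1 := by
    change (Finsupp.single v (1 : ℝ)) v = 1
    simp
  rw [h2]
  have h3 := t.2.1
  have h4 := sub_nonneg.mpr t.2.2
  rcases h3.lt_or_eq with h5 | h5
  · positivity
  · rw [← h5]
    simpa using h1.ne'

lemma contractibleSpace_openStar (v : V) : ContractibleSpace (K.openStar v) := by
  let H : K.openStar v → C(I, K.Realization) := fun x =>
    (segment (joinable_vertexPoint x.2)).toContinuousMap
  have hH : Continuous H := by
    refine continuous_of_isOpen (isOpen_openStar v) H fun s hs => ?_
    by_cases hv : v ∈ s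
    · refine ContinuousMap.continuous_of_continuous_uncurry _ ?_
      have h1 : (K.vertexPoint v).weights.support ⊆ s := by
        rw [support_vertexPoint]
        exact Finset.singleton_subset_iff.mpr hv
      exact (continuous_incl hs).comp (continuous_lerp hs
        (continuous_subtype_val.comp continuous_fst)
        (continuous_const (y := ClosedSimplex.of (K.vertexPoint v) h1)) continuous_snd)
    · have : IsEmpty {x : K.ClosedSimplex s // x.incl ∈ K.openStar v} :=
        ⟨fun x => hv (x.1.support_incl (Finsupp.mem_support_iff.mpr x.2))⟩
      exact continuous_of_discreteTopology
  have hH' := ContinuousMap.continuous_uncurry_of_continuous ⟨H, hH⟩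
  rw [contractible_iff_id_nullhomotopic]
  refine ⟨⟨K.vertexPoint v, vertexPoint_mem_openStar v⟩,
    ⟨⟨⟨fun q => ⟨H q.2 q.1, segment_mem_openStar q.2.2 q.1⟩, ?_⟩, fun x => ?_, fun x => ?_⟩⟩⟩
  · exact (hH'.comp continuous_swap).subtype_mk _
  · exact Subtype.ext (segment (joinable_vertexPoint x.2)).source
  · exact Subtype.ext (segment (joinable_vertexPoint x.2)).target

/-- The open star is contractible, so within it `p` is homotopic to the path through the vertex `v`.
-/
lemma pathClass_eq_of_mem_openStar {x y : K.Realization} {v : V} (hx : x ∈ K.openStar v)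
    (hy : y ∈ K.openStar v) (p : Path x y) (hp : ∀ t, p t ∈ K.openStar v) :
    pathClass p = pathClass (segment (joinable_vertexPoint hx)) ≫
      pathClass (segment (joinable_vertexPoint hy).symm) := by
  have := contractibleSpace_openStar (K := K) v
  have hsymm : segment (joinable_vertexPoint hy).symm = (segment (joinable_vertexPoint hy)).symm := by
    ext1
    funext t
    refine Realization.ext fun w => ?_
    change _ = (segment (joinable_vertexPoint hy) (σ t)).weights w
    have h1 : ((σ t : I) : ℝ) = 1 - t := rfl
    simp only [segment_apply, h1]
    ring
  let q := (segment (joinable_vertexPoint hx)).trans (segment (joinable_vertexPoint hy).symm)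
  have hq : ∀ t, q t ∈ K.openStar v := by
    have h1 : Set.range q ⊆ K.openStar v := by
      rw [Path.trans_range, hsymm, Path.symm_range]
      refine Set.union_subset ?_ ?_
      · rintro _ ⟨t, rfl⟩; exact segment_mem_openStar hx t
      · rintro _ ⟨t, rfl⟩; exact segment_mem_openStar hy t
    exact fun t => h1 ⟨t, rfl⟩
  let p' : Path (⟨x, hx⟩ : K.openStar v) ⟨y, hy⟩ :=
    { toFun := fun t => ⟨p t, hp t⟩
      continuous_toFun := p.continuous.subtype_mk _
      source' := Subtype.ext p.source
      target' := Subtype.ext p.target }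
  let q' : Path (⟨x, hx⟩ : K.openStar v) ⟨y, hy⟩ :=
    { toFun := fun t => ⟨q t, hq t⟩
      continuous_toFun := q.continuous.subtype_mk _
      source' := Subtype.ext q.source
      target' := Subtype.ext q.target }
  have h := (SimplyConnectedSpace.paths_homotopic p' q').map ⟨_, continuous_subtype_val⟩
  rw [← pathClass_trans]
  exact pathClass_eq h

end AbstractSimplicialComplex

/-! ### Simple connectedness from trivial cocycles -/

namespace SimpleGraph

open CategoryTheory

universe u

variable {V : Type u} {G : SimpleGraph V}

/-- Compatible morphisms along the edges of a graph with trivial cocycles come from a potential. -/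
lemma CocyclesTrivial.exists_potential (h : G.CocyclesTrivial) (hG : G.Connected) {C : Type u}
    [Groupoid.{u} C] (X : V → C) (S : ∀ a b, G.Near a b → (X a ⟶ X b))
    (hS : ∀ a b d (hab : G.Near a b) (hbd : G.Near b d) (had : G.Near a d),
      S a b hab ≫ S b d hbd = S a d had) (u : V) :
    ∃ k : ∀ v, X u ⟶ X v, ∀ a b (hab : G.Near a b), k a ≫ S a b hab = k b := by
  classical
  have hwalk : ∀ v, Nonempty (X u ⟶ X v) := by
    intro v
    obtain ⟨p⟩ := hG.preconnected u v
    induction p with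
    | nil => exact ⟨𝟙 _⟩
    | cons hadj _ ih => exact ⟨S _ _ hadj.near ≫ ih.some⟩
  let g : ∀ v, X u ⟶ X v := fun v => (hwalk v).some
  -- Closing up the morphisms along edges by arbitrary morphisms from `X u` gives a cocycle in the
  -- vertex group.
  let c : V → V → (X u ⟶ X u) := fun a b =>
    if hab : G.Near a b then g a ≫ S a b hab ≫ inv (g b) else 𝟙 _
  have hc : ∀ a b (hab : G.Near a b), c a b = g a ≫ S a b hab ≫ inv (g b) :=
    fun a b hab => dif_pos hab
  obtain ⟨f, hf⟩ := h (X u ⟶ X u) c fun a b d hab hbd had => by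
    rw [Groupoid.vertexGroup_mul, hc _ _ hab, hc _ _ hbd, hc _ _ had, ← hS a b d hab hbd had]
    simp
  refine ⟨fun v => f v ≫ g v, fun a b hab => ?_⟩
  have h1 : f a ≫ c a b = f b := by
    have h2 : f a * c a b = f b := by rw [hf a b hab, mul_inv_cancel_left]
    exact h2
  change (f a ≫ g a) ≫ _ = f b ≫ g b
  rw [← h1, hc a b hab]
  simp

end SimpleGraph

namespace AbstractSimplicialComplex

open CategoryTheory
open scoped unitInterval

universe u

variable {V : Type u} {K : AbstractSimplicialComplex V} {G : SimpleGraph V}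

/-- The simplices of `K` are cliques of `G`, and all vertices, edges and triangles of `G` are
simplices of `K`. -/
def HasTwoSkeleton (K : AbstractSimplicialComplex V) (G : SimpleGraph V) : Prop :=
  (∀ s ∈ K.faces, ∀ a ∈ s, ∀ b ∈ s, G.Near a b) ∧
    ∀ a b d, G.Near a b → G.Near b d → G.Near a d → ∃ s ∈ K.faces, a ∈ s ∧ b ∈ s ∧ d ∈ s

lemma support_vertexPoint_subset {s : Finset V} {v : V} (hv : v ∈ s) :
    (K.vertexPoint v).weights.support ⊆ s := by
  rw [support_vertexPoint]
  exact Finset.singleton_subset_iff.mpr hv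

lemma joinable_vertexPoints (hK : K.HasTwoSkeleton G) {a b : V} (hab : G.Near a b) :
    Joinable (K.vertexPoint a) (K.vertexPoint b) :=
  let ⟨s, hs, ha, hb, _⟩ := hK.2 a b b hab (.refl b) hab
  ⟨s, hs, support_vertexPoint_subset ha, support_vertexPoint_subset hb⟩

lemma pathClass_segment_comp_vertexPoint {x y : K.Realization} {v : V} (hx : x ∈ K.openStar v)
    (hxy : Joinable x y) (hy : y ∈ K.openStar v) :
    pathClass (segment (joinable_vertexPoint hx).symm) ≫ pathClass (segment hxy) =
      pathClass (segment (joinable_vertexPoint hy).symm) := by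
  obtain ⟨s, hs, hxs, hys⟩ := hxy
  exact pathClass_segment_comp _ _ _ hs
    (support_vertexPoint_subset (hxs (Finsupp.mem_support_iff.mpr hx))) hxs hys

lemma Realization.exists_mem_openStar (x : K.Realization) : ∃ v, x ∈ K.openStar v :=
  x.support_nonempty.imp fun _ hv => Finsupp.mem_support_iff.mp hv

/-- A van Kampen argument. The segments between vertices have a potential `k` in the fundamental
groupoid, which extends to classes `κ x` for all points. Composition with a path takes `κ` at its
source to `κ` at its target, first inside an open star and then, after subdivision, in general. So
the class of a path depends only on its ends. -/
theorem HasTwoSkeleton.simplyConnectedSpace (hK : K.HasTwoSkeleton G) (hG : G.Connected)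
    (h : G.CocyclesTrivial) : SimplyConnectedSpace K.Realization := by
  obtain ⟨u⟩ := hG.nonempty
  obtain ⟨k, hk⟩ := h.exists_potential hG (fun v => FundamentalGroupoid.mk (K.vertexPoint v))
    (fun a b hab => pathClass (segment (joinable_vertexPoints hK hab)))
    (fun a b d hab hbd had => by
      obtain ⟨s, hs, ha, hb, hd⟩ := hK.2 a b d hab hbd had
      exact pathClass_segment_comp _ _ _ hs (support_vertexPoint_subset ha)
        (support_vertexPoint_subset hb) (support_vertexPoint_subset hd)) u
  choose i hi using fun x : K.Realization => x.exists_mem_openStar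
  let κ : ∀ x : K.Realization, FundamentalGroupoid.mk (K.vertexPoint u) ⟶ FundamentalGroupoid.mk x :=
    fun x => k (i x) ≫ pathClass (segment (joinable_vertexPoint (hi x)).symm)
  have hκ : ∀ (x : K.Realization) (v : V) (hv : x ∈ K.openStar v),
      κ x = k v ≫ pathClass (segment (joinable_vertexPoint hv).symm) := by
    intro x v hv
    have hiv : i x ∈ x.weights.support := Finsupp.mem_support_iff.mpr (hi x)
    have hvv : v ∈ x.weights.support := Finsupp.mem_support_iff.mpr hv
    have hn : G.Near (i x) v := hK.1 _ x.support_mem _ hiv _ hvv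
    rw [← hk (i x) v hn, Category.assoc, pathClass_segment_comp _ _
      (joinable_vertexPoint (hi x)).symm x.support_mem (support_vertexPoint_subset hiv)
      (support_vertexPoint_subset hvv) subset_rfl]
  have hloc : ∀ {x y : K.Realization} (v : V) (p : Path x y), (∀ t, p t ∈ K.openStar v) →
      κ x ≫ pathClass p = κ y := by
    intro x y v p hp
    have hx : x ∈ K.openStar v := by simpa using hp 0
    have hy : y ∈ K.openStar v := by simpa using hp 1
    rw [hκ x v hx, hκ y v hy, pathClass_eq_of_mem_openStar hx hy p hp, Category.assoc]
    congr 1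
    rw [← Category.assoc, pathClass_segment_comp_vertexPoint hx (joinable_vertexPoint hx)
      (vertexPoint_mem_openStar v)]
    exact pathClass_segment_comp_vertexPoint (vertexPoint_mem_openStar v) _ hy
  have hall : ∀ {x y : K.Realization} (p : Path x y), κ x ≫ pathClass p = κ y := by
    intro x y p
    obtain ⟨t, ht0, htm, ⟨n, htn⟩, htc⟩ := exists_monotone_Icc_subset_open_cover_unitInterval
      (c := fun v : V => p ⁻¹' K.openStar v)
      (fun v => (isOpen_openStar v).preimage p.continuous)
      (fun r _ => Set.mem_iUnion.mpr ⟨i (p r), hi (p r)⟩)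
    have hstep : ∀ m, κ (p 0) ≫ pathClass (p.subpath 0 (t m)) = κ (p (t m)) := by
      intro m
      induction m with
      | zero =>
        rw [ht0]
        refine hloc (i (p 0)) _ fun r => ?_
        rw [Path.subpath_self]
        exact hi (p 0)
      | succ m ih =>
        obtain ⟨v, hv⟩ := htc m
        rw [← pathClass_eq ⟨Path.Homotopy.subpathTransSubpath p 0 (t m) (t (m + 1))⟩,
          pathClass_trans, ← Category.assoc, ih]
        refine hloc v _ fun r => ?_
        have h1 : p.subpath (t m) (t (m + 1)) r ∈ p '' Set.Icc (t m) (t (m + 1)) := by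
          rw [← Path.range_subpath_of_le _ _ _ (htm m.le_succ)]
          exact ⟨r, rfl⟩
        obtain ⟨r', hr', h2⟩ := h1
        rw [← h2]
        exact hv hr'
    have h1 := hstep n
    rw [htn n le_rfl, Path.subpath_zero_one] at h1
    have hcast : ∀ {x y x' y' : K.Realization} (p : Path x y) (hx : x' = x) (hy : y' = y),
        κ x' ≫ pathClass (p.cast hx hy) = κ y' → κ x ≫ pathClass p = κ y := by
      rintro x y _ _ p rfl rfl h
      exact h
    exact hcast p _ _ h1
  rw [simply_connected_iff_unique_homotopic]
  refine ⟨⟨K.vertexPoint u⟩, fun x y => ⟨⟨⟨inv (κ x) ≫ κ y⟩, fun q => ?_⟩⟩⟩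
  induction q using Quotient.inductionOn with
  | h p =>
    have h1 : pathClass p = inv (κ x) ≫ κ y := by
      rw [← hall p, IsIso.inv_hom_id_assoc]
    exact h1

end AbstractSimplicialComplex

/-! ### Trivial cocycles from simple connectedness -/

namespace AbstractSimplicialComplex

open scoped unitInterval

universe u

variable {V : Type u} {K : AbstractSimplicialComplex V} {G : SimpleGraph V}

/-- A vertex of the carrier of a point of the realization. -/
noncomputable def Realization.index (x : K.Realization) : V := x.exists_mem_openStar.choose

lemma Realization.mem_openStar_index (x : K.Realization) : x ∈ K.openStar x.index :=
  x.exists_mem_openStar.choose_spec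

lemma Realization.index_mem_support (x : K.Realization) : x.index ∈ x.weights.support :=
  Finsupp.mem_support_iff.mpr x.mem_openStar_index

lemma index_vertexPoint (v : V) : (K.vertexPoint v).index = v := by
  have h := (K.vertexPoint v).index_mem_support
  rwa [support_vertexPoint, Finset.mem_singleton] at h

lemma HasTwoSkeleton.near_of_mem_openStar (hK : K.HasTwoSkeleton G) {x : K.Realization} {a b : V}
    (ha : x ∈ K.openStar a) (hb : x ∈ K.openStar b) : G.Near a b :=
  hK.1 _ x.support_mem _ (Finsupp.mem_support_iff.mpr ha) _ (Finsupp.mem_support_iff.mpr hb)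

/-- A cocycle on the edges. -/
def IsCocycle (G : SimpleGraph V) {Γ : Type*} [Group Γ] (c : V → V → Γ) : Prop :=
  ∀ a b d, G.Near a b → G.Near b d → G.Near a d → c a b * c b d = c a d

lemma IsCocycle.self {Γ : Type*} [Group Γ] {c : V → V → Γ} (hc : IsCocycle G c) (a : V) :
    c a a = 1 := by
  have := hc a a a (.refl a) (.refl a) (.refl a)
  simpa using this

/-- The bundle over the realization with discrete fibre defined by a cocycle. -/
noncomputable def cocycleBundle {Γ : Type u} [Group Γ] [TopologicalSpace Γ] [DiscreteTopology Γ]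
    (hK : K.HasTwoSkeleton G) {c : V → V → Γ} (hc : IsCocycle G c) :
    FiberBundleCore V K.Realization Γ where
  baseSet := K.openStar
  isOpen_baseSet := isOpen_openStar
  indexAt x := x.index
  mem_baseSet_at x := x.mem_openStar_index
  coordChange a b _ g := g * c a b
  coordChange_self a _ _ g := by rw [hc.self, mul_one]
  continuousOn_coordChange a b :=
    ((continuous_of_discreteTopology (f := fun g : Γ => g * c a b)).comp continuous_snd).continuousOn
  coordChange_comp a b d x hx g := by
    rw [mul_assoc, hc a b d (hK.near_of_mem_openStar hx.1.1 hx.1.2)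
      (hK.near_of_mem_openStar hx.1.2 hx.2) (hK.near_of_mem_openStar hx.1.1 hx.2)]

section

variable {Γ : Type u} [Group Γ] [TopologicalSpace Γ] [DiscreteTopology Γ]
  (hK : K.HasTwoSkeleton G) {c : V → V → Γ} (hc : IsCocycle G c)

/-- The point over a vertex with a given coordinate. -/
noncomputable def cocycleBundlePoint (a : V) (g : Γ) : (cocycleBundle hK hc).TotalSpace :=
  ⟨K.vertexPoint a, g⟩

lemma isCoveringMap_cocycleBundle :
    IsCoveringMap (Bundle.TotalSpace.proj : (cocycleBundle hK hc).TotalSpace → K.Realization) :=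
  FiberBundle.isCoveringMap (F := Γ) (E := (cocycleBundle hK hc).Fiber)

/-- The lift of the segment between two adjacent vertices. -/
noncomputable def liftSegment {a b : V} (hab : G.Near a b) (g : Γ) :
    Path (cocycleBundlePoint hK hc a g) (cocycleBundlePoint hK hc b (g * c a b)) where
  -- In the chart of `a` the lift has constant coordinate `g`. Written in the chart of the index
  -- vertex of each point, the formula also covers the endpoint over `b`.
  toFun t := ⟨segment (joinable_vertexPoints hK hab) t,
    g * c a (segment (joinable_vertexPoints hK hab) t).index⟩
  continuous_toFun := by
    obtain ⟨s, hs, ha, hb, -⟩ := hK.2 a b b hab (.refl b) hab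
    have hsupp : ∀ t, (segment (joinable_vertexPoints hK hab) t).weights.support ⊆ s := by
      intro t
      rw [segment_eq_map _ hs (support_vertexPoint_subset ha) (support_vertexPoint_subset hb)]
      exact (ClosedSimplex.segment hs _ _ t).support_incl
    refine continuous_iff_continuousAt.mpr fun t₀ => ?_
    rw [FiberBundle.continuousAt_totalSpace Γ]
    refine ⟨(segment (joinable_vertexPoints hK hab)).continuous.continuousAt, ?_⟩
    have h1 : ∀ t : I, g * c a (segment (joinable_vertexPoints hK hab) t).index *
        c (segment (joinable_vertexPoints hK hab) t).index
          (segment (joinable_vertexPoints hK hab) t₀).index =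
        g * c a (segment (joinable_vertexPoints hK hab) t₀).index := by
      intro t
      have h2 := hsupp t (Realization.index_mem_support _)
      have h3 := hsupp t₀ (Realization.index_mem_support _)
      rw [mul_assoc, hc _ _ _ (hK.1 s hs _ ha _ h2) (hK.1 s hs _ h2 _ h3) (hK.1 s hs _ ha _ h3)]
    refine (continuousAt_const (y := g * c a
      (segment (joinable_vertexPoints hK hab) t₀).index)).congr (Filter.Eventually.of_forall ?_)
    intro t
    exact (h1 t).symm
  source' := by
    rw [Path.source, index_vertexPoint, hc.self, mul_one]
    rfl
  target' := by
    rw [Path.target, index_vertexPoint]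
    rfl

end

/-- The cocycle glues a covering with fibre `Γ` from the open stars. Monodromy from a base point
gives the coordinate `f v` over each vertex; lifting an edge multiplies the coordinate by the
cocycle, and simple connectedness makes the choice of path irrelevant. -/
theorem HasTwoSkeleton.cocyclesTrivial (hK : K.HasTwoSkeleton G)
    [SimplyConnectedSpace K.Realization] : G.CocyclesTrivial := by
  intro Γ _ c hc
  let _ : TopologicalSpace Γ := ⊥
  have : DiscreteTopology Γ := ⟨rfl⟩
  replace hc : IsCocycle G c := hc
  have cov := isCoveringMap_cocycleBundle hK hc
  obtain ⟨x⟩ : Nonempty K.Realization := inferInstance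
  let u := x.index
  let γ : ∀ v, Path.Homotopic.Quotient (K.vertexPoint u) (K.vertexPoint v) := fun v =>
    .mk (PathConnectedSpace.somePath _ _)
  let e := fun v => cov.monodromy (γ v) ⟨cocycleBundlePoint hK hc u 1, rfl⟩
  have he : ∀ v, ∃ g : Γ, e v = ⟨cocycleBundlePoint hK hc v g, rfl⟩ := by
    rintro v
    obtain ⟨⟨y, g⟩, hy⟩ := e v
    obtain rfl : y = K.vertexPoint v := hy
    exact ⟨g, rfl⟩
  choose f hf using he
  refine ⟨f, fun a b hab => ?_⟩
  have h1 := cov.monodromy_map (.mk (liftSegment hK hc hab (f a)))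
  have h2 : γ b = (γ a).trans (.mk (segment (joinable_vertexPoints hK hab))) :=
    Subsingleton.elim _ _
  have h3 : e b = cov.monodromy (.mk (segment (joinable_vertexPoints hK hab))) (e a) := by
    change cov.monodromy (γ b) _ = _
    rw [h2, cov.monodromy_trans_apply]
  have h4 : e b = ⟨cocycleBundlePoint hK hc b (f a * c a b), rfl⟩ := by
    rw [h3, hf a]
    exact h1
  rw [hf b] at h4
  have h5 : cocycleBundlePoint hK hc b (f b) = cocycleBundlePoint hK hc b (f a * c a b) :=
    congrArg Subtype.val h4
  have h6 : f b = f a * c a b := eq_of_heq (Bundle.TotalSpace.mk.inj h5).2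
  rw [h6, inv_mul_cancel_left]

/-- A graph whose complex has a connected realization is connected. -/
theorem HasTwoSkeleton.connected (hK : K.HasTwoSkeleton G) [ConnectedSpace K.Realization] :
    G.Connected := by
  obtain ⟨x⟩ : Nonempty K.Realization := inferInstance
  let S : V → Set K.Realization := fun u => ⋃ v ∈ {v | G.Reachable u v}, K.openStar v
  have hS : ∀ u, IsOpen (S u) := fun u => isOpen_biUnion fun v _ => isOpen_openStar v
  have hmem : ∀ u (y : K.Realization), y ∈ S u ↔ G.Reachable u y.index := by
    intro u y
    simp only [S, Set.mem_iUnion, Set.mem_ofPred_eq, exists_prop]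
    refine ⟨?_, fun h => ⟨_, h, y.mem_openStar_index⟩⟩
    rintro ⟨v, hv, hy⟩
    rcases hK.near_of_mem_openStar hy y.mem_openStar_index with h | h
    · rwa [← h]
    · exact hv.trans h.reachable
  have : Nonempty V := ⟨x.index⟩
  refine ⟨fun u v => ?_⟩
  have hclopen : IsClopen (S u) := by
    refine ⟨⟨?_⟩, hS u⟩
    have h1 : (S u)ᶜ = ⋃ w ∈ {w | ¬ G.Reachable u w}, S w := by
      ext y
      simp only [Set.mem_compl_iff, hmem, Set.mem_iUnion, Set.mem_ofPred_eq, exists_prop]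
      refine ⟨fun h => ⟨_, h, .refl _⟩, ?_⟩
      rintro ⟨w, hw, hy⟩ h
      exact hw (h.trans hy.symm)
    rw [h1]
    exact isOpen_biUnion fun w _ => hS w
  have h2 : K.vertexPoint u ∈ S u := by rw [hmem, index_vertexPoint]
  have h3 : K.vertexPoint v ∈ S u := by
    rw [hclopen.eq_univ ⟨_, h2⟩]
    trivial
  rwa [hmem, index_vertexPoint] at h3

end AbstractSimplicialComplex

/-! ### Contracting the clique complex -/

namespace SimpleGraph

universe u

variable {V : Type u} {G : SimpleGraph V}

/-- A ball-dominated graph retracts onto the balls around `u` compatibly. -/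
lemma BallDominated.exists_retractions {u : V} (h : G.BallDominated u) (hG : G.Connected) :
    ∃ g : ℕ → V → V, (∀ v, g 0 v = u) ∧ (∀ j v, G.dist u v ≤ j → g j v = v) ∧
      ∀ j x y, G.Near x y → G.Near (g j x) (g j y) ∧ G.Near (g j x) (g (j + 1) y) := by
  -- The map `f` moves a vertex one level down and dominates the part of its unit ball that is no
  -- further from `u`. By truncated subtraction it fixes `u`.
  have hex : ∀ v, ∃ p, G.dist u p ≤ G.dist u v - 1 ∧
      ∀ y, G.Near v y → G.dist u y ≤ G.dist u v - 1 + 1 → G.Near p y :=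
    fun v => h (G.dist u v - 1) v (by omega)
  choose f hf1 hf2 using hex
  have hdist : ∀ i v, G.dist u (f^[i] v) = G.dist u v - i := by
    intro i v
    induction i with
    | zero => rfl
    | succ i ih =>
      rw [Function.iterate_succ_apply']
      have h1 := hf1 (f^[i] v)
      have h2 := (hf2 (f^[i] v) _ .rfl (by omega)).dist_le
      have h3 := hG.dist_triangle (u := u) (v := f (f^[i] v)) (w := f^[i] v)
      omega
  let g : ℕ → V → V := fun j v => f^[G.dist u v - j] v
  have hid : ∀ j v, G.dist u v ≤ j → g j v = v := by
    intro j v hv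
    simp only [g, Nat.sub_eq_zero_of_le hv, Function.iterate_zero_apply]
  have hg : ∀ j v, G.dist u (g j v) ≤ j := by
    intro j v
    simp only [g, hdist]
    omega
  have hstep : ∀ j v, g j v = g (j + 1) v ∨
      g j v = f (g (j + 1) v) ∧ G.dist u (g (j + 1) v) = j + 1 := by
    intro j v
    by_cases hv : G.dist u v ≤ j
    · left
      rw [hid j v hv, hid (j + 1) v (by omega)]
    · right
      simp only [g, hdist]
      refine ⟨?_, by omega⟩
      rw [← Function.iterate_succ_apply' f]
      congr 2
      omega
  have hone : ∀ j v y, G.Near (g (j + 1) v) y → G.dist u y ≤ j + 1 → G.Near (g j v) y := by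
    intro j v y hy hd
    rcases hstep j v with h1 | ⟨h1, h2⟩
    · rwa [h1]
    · rw [h1]
      exact hf2 _ y hy (by omega)
  -- Descending induction on the level, with `i` bounding the height above `j`: first `x` and then
  -- `y` is moved from stage `j + 1` to stage `j`, and domination keeps the images near.
  have hnear : ∀ i j x y, G.dist u x ≤ j + i → G.dist u y ≤ j + i → G.Near x y →
      G.Near (g j x) (g j y) := by
    intro i
    induction i with
    | zero =>
      intro j x y hx hy hxy
      rwa [hid j x hx, hid j y hy]
    | succ i ih =>
      intro j x y hx hy hxy
      have h1 := ih (j + 1) x y (by omega) (by omega) hxy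
      have h2 := hone j x _ h1 (hg (j + 1) y)
      exact (hone j y _ h2.symm ((hg j x).trans j.le_succ)).symm
  have hnear' : ∀ j x y, G.Near x y → G.Near (g j x) (g j y) := fun j x y hxy =>
    hnear (G.dist u x + G.dist u y) j x y (by omega) (by omega) hxy
  refine ⟨g, fun v => ?_, hid, fun j x y hxy => ⟨hnear' j x y hxy, ?_⟩⟩
  · exact ((hG.preconnected u _).dist_eq_zero_iff.mp (Nat.le_zero.mp (hg 0 v))).symm
  · exact hone j x _ (hnear' (j + 1) x y hxy) (hg (j + 1) y)

end SimpleGraph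

namespace AbstractSimplicialComplex

open scoped unitInterval

universe u

variable {V : Type u} {G : SimpleGraph V}

lemma mem_cliqueComplex_iff {s : Finset V} :
    s ∈ G.cliqueComplex.faces ↔ s.Nonempty ∧ ∀ a ∈ s, ∀ b ∈ s, G.Near a b := by
  change s.Nonempty ∧ G.IsClique (s : Set V) ↔ _
  rw [SimpleGraph.isClique_iff_near]
  rfl

open Classical in
lemma mapDomain_apply_eq_sum (g : V → V) (x : V →₀ ℝ) {s : Finset V} (hs : x.support ⊆ s) (w : V) :
    Finsupp.mapDomain g x w = ∑ v ∈ s, if g v = w then x v else 0 := by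
  rw [Finsupp.mapDomain, Finsupp.sum_apply, Finsupp.sum_of_support_subset _ hs _ (by simp)]
  simp only [Finsupp.single_apply]

/-- The map of the realization of the clique complex induced by a map of the vertices. -/
noncomputable def push (g : V → V) (hg : ∀ x y, G.Near x y → G.Near (g x) (g y))
    (x : G.cliqueComplex.Realization) : G.cliqueComplex.Realization :=
  ⟨Finsupp.mapDomain g x.weights, fun w => by
      classical
      rw [mapDomain_apply_eq_sum g x.weights subset_rfl]
      refine Finset.sum_nonneg fun v _ => ?_
      split_ifs
      exacts [x.weights_nonneg v, le_rfl], by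
      classical
      have h1 : (Finsupp.mapDomain g x.weights).sum (fun _ a => a) = 1 := by
        rw [Finsupp.sum_mapDomain_index (by simp) (by simp), x.sum_weights]
      rw [mem_cliqueComplex_iff]
      constructor
      · rw [Finsupp.support_nonempty_iff]
        intro h2
        simp [h2] at h1
      · intro a ha b hb
        obtain ⟨a', ha', rfl⟩ := Finset.mem_image.mp (Finsupp.mapDomain_support ha)
        obtain ⟨b', hb', rfl⟩ := Finset.mem_image.mp (Finsupp.mapDomain_support hb)
        exact hg _ _ ((mem_cliqueComplex_iff.mp x.support_mem).2 _ ha' _ hb'), by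
      rw [Finsupp.sum_mapDomain_index (by simp) (by simp), x.sum_weights]⟩

lemma weights_push (g : V → V) (hg : ∀ x y, G.Near x y → G.Near (g x) (g y))
    (x : G.cliqueComplex.Realization) :
    (push g hg x).weights = Finsupp.mapDomain g x.weights := rfl

open Classical in
lemma support_push_subset (g : V → V) (hg : ∀ x y, G.Near x y → G.Near (g x) (g y))
    {x : G.cliqueComplex.Realization} {s : Finset V} (hs : x.weights.support ⊆ s) :
    (push g hg x).weights.support ⊆ s.image g :=
  Finsupp.mapDomain_support.trans (Finset.image_subset_image hs)

lemma push_eq_self {g : V → V} (hg : ∀ x y, G.Near x y → G.Near (g x) (g y))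
    {x : G.cliqueComplex.Realization} (h : ∀ v ∈ x.weights.support, g v = v) : push g hg x = x := by
  refine Realization.ext fun v => ?_
  rw [weights_push, Finsupp.mapDomain_congr (g := id) h, Finsupp.mapDomain_id]

lemma push_const {u : V} {g : V → V} (hg : ∀ x y, G.Near x y → G.Near (g x) (g y))
    (h : ∀ v, g v = u) (x : G.cliqueComplex.Realization) :
    push g hg x = G.cliqueComplex.vertexPoint u := by
  refine Realization.ext fun v => ?_
  have h1 : Finsupp.mapDomain g x.weights = Finsupp.single u 1 := by
    rw [Finsupp.mapDomain_congr (g := fun _ => u) fun v _ => h v, Finsupp.mapDomain,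
      ← Finsupp.single_sum, x.sum_weights]
  rw [weights_push, h1]
  rfl

lemma segment_self_apply {K : AbstractSimplicialComplex V} {x y : K.Realization}
    (h : Joinable x y) (hxy : x = y) (t : I) : segment h t = x := by
  subst hxy
  refine Realization.ext fun v => ?_
  rw [segment_apply]
  ring

section

variable (g : ℕ → V → V)
  (hg : ∀ j x y, G.Near x y → G.Near (g j x) (g j y) ∧ G.Near (g j x) (g (j + 1) y))

/-- The realization of the map `g j`. -/
noncomputable def pushSeq (j : ℕ) : G.cliqueComplex.Realization → G.cliqueComplex.Realization :=
  push (g j) fun x y hxy => (hg j x y hxy).1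

open Classical in
include hg in
lemma image_union_mem_faces (j : ℕ) {s : Finset V} (hs : s ∈ G.cliqueComplex.faces) :
    s.image (g j) ∪ s.image (g (j + 1)) ∈ G.cliqueComplex.faces := by
  rw [mem_cliqueComplex_iff] at hs ⊢
  refine ⟨(hs.1.image _).mono Finset.subset_union_left, ?_⟩
  intro a ha b hb
  rcases Finset.mem_union.mp ha with ha | ha <;> rcases Finset.mem_union.mp hb with hb | hb <;>
    obtain ⟨a', ha', rfl⟩ := Finset.mem_image.mp ha <;>
    obtain ⟨b', hb', rfl⟩ := Finset.mem_image.mp hb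
  · exact (hg j _ _ (hs.2 _ ha' _ hb')).1
  · exact (hg j _ _ (hs.2 _ ha' _ hb')).2
  · exact (hg j _ _ (hs.2 _ hb' _ ha')).2.symm
  · exact (hg (j + 1) _ _ (hs.2 _ ha' _ hb')).1

open Classical in
lemma support_pushSeq_subset (j : ℕ) {x : G.cliqueComplex.Realization} {s : Finset V}
    (hs : x.weights.support ⊆ s) : (pushSeq g hg j x).weights.support ⊆ s.image (g j) :=
  support_push_subset _ _ hs

lemma joinable_pushSeq (j : ℕ) (x : G.cliqueComplex.Realization) :
    Joinable (pushSeq g hg j x) (pushSeq g hg (j + 1) x) := by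
  classical
  exact ⟨_, image_union_mem_faces g hg j x.support_mem,
    (support_pushSeq_subset g hg _ subset_rfl).trans Finset.subset_union_left,
    (support_pushSeq_subset g hg _ subset_rfl).trans Finset.subset_union_right⟩

/-- The piecewise linear interpolation of the maps `g j`. -/
noncomputable def interpolate (x : G.cliqueComplex.Realization) (r : ℝ) :
    G.cliqueComplex.Realization :=
  segment (joinable_pushSeq g hg ⌊r⌋₊ x) (Set.projIcc 0 1 zero_le_one (r - ⌊r⌋₊))

/-- At the right end `r = j + 1` the segment ends where the next one starts. The formula thus holds
on a closed interval, as gluing requires. -/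
lemma interpolate_eq (x : G.cliqueComplex.Realization) {r : ℝ} {j : ℕ} (h1 : (j : ℝ) ≤ r)
    (h2 : r ≤ j + 1) :
    interpolate g hg x r = segment (joinable_pushSeq g hg j x)
      (Set.projIcc 0 1 zero_le_one (r - j)) := by
  rcases h2.lt_or_eq with h3 | rfl
  · have h4 : ⌊r⌋₊ = j := (Nat.floor_eq_iff ((Nat.cast_nonneg j).trans h1)).mpr ⟨h1, h3⟩
    subst h4
    rfl
  · have h4 : ⌊(j : ℝ) + 1⌋₊ = j + 1 := by exact_mod_cast Nat.floor_natCast (j + 1)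
    simp only [interpolate, h4]
    have h5 : Set.projIcc (0 : ℝ) 1 zero_le_one ((j : ℝ) + 1 - ((j + 1 : ℕ) : ℝ)) = 0 :=
      Set.projIcc_of_le_left _ (by push_cast; linarith)
    have h6 : Set.projIcc (0 : ℝ) 1 zero_le_one ((j : ℝ) + 1 - j) = 1 :=
      Set.projIcc_of_right_le _ (by linarith)
    rw [h5, h6, Path.source, Path.target, h4]

variable {u : V} (hid : ∀ j v, G.dist u v ≤ j → g j v = v)

include hid in
lemma interpolate_eq_self {x : G.cliqueComplex.Realization} {N : ℕ}
    (hx : ∀ v ∈ x.weights.support, G.dist u v ≤ N) {r : ℝ} (hr : N ≤ r) :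
    interpolate g hg x r = x := by
  have h1 : N ≤ ⌊r⌋₊ := Nat.le_floor hr
  have h2 : pushSeq g hg ⌊r⌋₊ x = x := push_eq_self _ fun v hv => hid _ v ((hx v hv).trans h1)
  have h3 : pushSeq g hg (⌊r⌋₊ + 1) x = x :=
    push_eq_self _ fun v hv => hid _ v ((hx v hv).trans (h1.trans (Nat.le_succ _)))
  rw [interpolate, segment_self_apply _ (h2.trans h3.symm), h2]

/-- The contracting homotopy. -/
noncomputable def contraction (p : G.cliqueComplex.Realization × I) : G.cliqueComplex.Realization :=
  open Classical in
  -- Time `t` corresponds to stage `1 / t - 1`, from the constant map at `t = 1` through all stages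
  -- as `t` tends to 0.
  if p.2 = 0 then p.1 else interpolate g hg p.1 (1 / p.2 - 1)

-- On a simplex within distance `N` of `u`, the stages from `N` on are the identity. Cutting time
-- off at `1 / (N + 1)` changes nothing and removes the singularity at 0.
include hid in
lemma contraction_eq {x : G.cliqueComplex.Realization} {N : ℕ}
    (hx : ∀ v ∈ x.weights.support, G.dist u v ≤ N) (t : I) :
    contraction g hg (x, t) = interpolate g hg x (1 / max (t : ℝ) (1 / (N + 1)) - 1) := by
  have hN : (0 : ℝ) < 1 / (N + 1) := by positivity
  rcases le_or_gt (1 / ((N : ℝ) + 1)) t with h | h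
  · rw [max_eq_left h, contraction, if_neg]
    intro h0
    have h0 : (t : ℝ) = 0 := congrArg Subtype.val h0
    linarith
  · rw [max_eq_right h.le, interpolate_eq_self g hg hid hx (by rw [one_div_one_div]; linarith)]
    rw [contraction]
    split_ifs with h0
    · rfl
    · have h1 : 0 < (t : ℝ) := lt_of_le_of_ne t.2.1 fun h2 => h0 (Subtype.ext h2.symm)
      refine interpolate_eq_self g hg hid hx ?_
      have h2 : (N : ℝ) + 1 < 1 / t := by
        rw [lt_one_div (by positivity) h1]
        exact h
      change (N : ℝ) ≤ 1 / (t : ℝ) - 1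
      linarith

-- It suffices to consider one simplex at a time. There finitely many closed time slabs remain, and
-- on each of them the homotopy runs straight inside a single simplex.
include hid in
lemma continuous_contraction : Continuous (contraction g hg) := by
  classical
  refine continuous_realization_prod _ fun s hs => ?_
  let N : ℕ := s.sup fun v => G.dist u v
  let τ : I → ℝ := fun t => 1 / max (t : ℝ) (1 / (N + 1)) - 1
  have hpos : (0 : ℝ) < 1 / (N + 1) := by positivity
  have hτ : Continuous τ := by
    refine Continuous.sub (continuous_const.div
      (continuous_subtype_val.max continuous_const) fun t => ?_) continuous_const
    exact (lt_max_of_lt_right hpos).ne'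
  have hτ0 : ∀ t, 0 ≤ τ t := fun t => by
    have h1 : max (t : ℝ) (1 / (N + 1)) ≤ 1 := max_le t.2.2 (by
      rw [div_le_one (by positivity)]
      linarith [(Nat.cast_nonneg N : (0 : ℝ) ≤ N)])
    have h2 := one_le_one_div (lt_max_of_lt_right hpos) h1
    exact sub_nonneg.mpr h2
  have hτN : ∀ t, τ t ≤ N := fun t => by
    have h1 := one_div_le_one_div_of_le hpos (le_max_right (t : ℝ) (1 / (N + 1)))
    rw [one_div_one_div] at h1
    exact sub_le_iff_le_add.mpr h1
  have hH : ∀ p : G.cliqueComplex.ClosedSimplex s × I,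
      contraction g hg (p.1.incl, p.2) = interpolate g hg p.1.incl (τ p.2) := fun p =>
    contraction_eq g hg hid (fun v hv => Finset.le_sup (f := fun v => G.dist u v)
      (p.1.support_incl hv)) p.2
  simp only [hH]
  let C : Fin (N + 1) → Set (G.cliqueComplex.ClosedSimplex s × I) := fun j =>
    {p | τ p.2 ∈ Set.Icc (j : ℝ) (j + 1)}
  refine (locallyFinite_of_finite C).continuous ?_
    (fun j => isClosed_Icc.preimage (hτ.comp continuous_snd)) fun j => ?_
  · refine Set.eq_univ_of_forall fun p => Set.mem_iUnion.mpr ?_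
    refine ⟨⟨⌊τ p.2⌋₊, Nat.lt_succ_of_le (Nat.floor_le_of_le (hτN p.2))⟩, ?_, ?_⟩
    · exact Nat.floor_le (hτ0 p.2)
    · exact (Nat.lt_floor_add_one (τ p.2)).le
  · have hpush : ∀ i, ∀ T (hT : s.image (g i) ⊆ T), Continuous
        fun p : G.cliqueComplex.ClosedSimplex s × I => ClosedSimplex.of (pushSeq g hg i p.1.incl)
          ((support_pushSeq_subset g hg _ p.1.support_incl).trans hT) := by
      intro i T hT
      refine continuous_to_closedSimplex fun w => ?_
      have h1 : ∀ p : G.cliqueComplex.ClosedSimplex s × I,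
          (pushSeq g hg i p.1.incl).weights w =
            ∑ v ∈ s, if g i v = w then p.1.incl.weights v else 0 := fun p =>
        mapDomain_apply_eq_sum _ _ p.1.support_incl w
      change Continuous fun p : G.cliqueComplex.ClosedSimplex s × I =>
        (pushSeq g hg i p.1.incl).weights w
      simp only [h1]
      refine continuous_finsetSum _ fun v _ => ?_
      split_ifs
      exacts [(continuous_closedSimplex_coord v).comp continuous_fst, continuous_const]
    have hT := image_union_mem_faces g hg j hs
    have hcont := (continuous_incl hT).comp (continuous_lerp hT
      (hpush j _ Finset.subset_union_left) (hpush (j + 1) _ Finset.subset_union_right)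
      ((continuous_projIcc (h := zero_le_one)).comp
        ((hτ.comp continuous_snd).sub (continuous_const (y := (j : ℝ))))))
    refine hcont.continuousOn.congr fun p hp => ?_
    rw [interpolate_eq g hg _ hp.1 hp.2]
    rfl

end

/-- The clique complex of a Helly graph is contractible. -/
theorem contractibleSpace_cliqueComplex {u : V} (h : G.BallDominated u) (hG : G.Connected) :
    ContractibleSpace G.cliqueComplex.Realization := by
  obtain ⟨g, hg0, hid, hg⟩ := h.exists_retractions hG
  rw [contractible_iff_id_nullhomotopic]
  refine ⟨G.cliqueComplex.vertexPoint u, ⟨⟨⟨fun q => contraction g hg (q.2, q.1),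
    (continuous_contraction g hg hid).comp continuous_swap⟩, fun x => if_pos rfl, fun x => ?_⟩⟩⟩
  change contraction g hg (x, 1) = G.cliqueComplex.vertexPoint u
  rw [contraction, if_neg one_ne_zero]
  have h1 : (1 / ((1 : I) : ℝ) - 1) = ((0 : ℕ) : ℝ) := by simp
  change interpolate g hg x (1 / ((1 : I) : ℝ) - 1) = _
  rw [h1, interpolate_eq g hg x (j := 0) le_rfl (by simp)]
  have h2 : Set.projIcc (0 : ℝ) 1 zero_le_one (((0 : ℕ) : ℝ) - ((0 : ℕ) : ℝ)) = 0 :=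
    Set.projIcc_of_le_left _ (by simp)
  rw [h2, Path.source]
  exact push_const _ hg0 x

end AbstractSimplicialComplex

/-! ### Coverings of the triangle complex -/

namespace AbstractSimplicialComplex

open SimpleGraph

lemma near_of_mem_faces {V : Type*} {K : AbstractSimplicialComplex V} {s : Finset V}
    (hs : s ∈ K.faces) {a b : V} (ha : a ∈ s) (hb : b ∈ s) : K.oneSkeleton.Near a b := by
  classical
  by_cases hab : a = b
  · exact Or.inl hab
  · refine Or.inr ⟨hab, mem_faces_of_subset hs ?_ (Finset.insert_nonempty _ _)⟩
    exact Finset.insert_subset_iff.mpr ⟨ha, Finset.singleton_subset_iff.mpr hb⟩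

open Classical in
lemma pair_mem_faces {V : Type*} {K : AbstractSimplicialComplex V} {a b : V}
    (h : K.oneSkeleton.Near a b) : ({a, b} : Finset V) ∈ K.faces := by
  rcases h with rfl | h
  · simpa using K.singleton_mem a
  · exact h.2

open Classical in
lemma triple_mem_triangleComplex {V : Type*} {G : SimpleGraph V} {a b d : V} (hab : G.Near a b)
    (hbd : G.Near b d) (had : G.Near a d) : ({a, b, d} : Finset V) ∈ G.triangleComplex.faces := by
  refine ⟨Finset.insert_nonempty _ _, ?_, Finset.card_le_three⟩
  rw [isClique_iff_near]
  have h1 := hab.symm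
  have h2 := hbd.symm
  have h3 := had.symm
  simp only [Finset.coe_insert, Finset.coe_singleton, Set.mem_insert_iff, Set.mem_singleton_iff]
  rintro x (rfl | rfl | rfl) y (rfl | rfl | rfl) <;> first | exact .rfl | assumption

lemma near_of_mem_triangleComplex {V : Type*} {G : SimpleGraph V} {s : Finset V}
    (hs : s ∈ G.triangleComplex.faces) {a b : V} (ha : a ∈ s) (hb : b ∈ s) : G.Near a b :=
  isClique_iff_near.mp hs.2.1 a ha b hb

lemma hasTwoSkeleton_triangleComplex {V : Type*} (G : SimpleGraph V) :
    G.triangleComplex.HasTwoSkeleton G := by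
  classical
  exact ⟨fun s hs a ha b hb => near_of_mem_triangleComplex hs ha hb,
    fun a b d hab hbd had => ⟨_, triple_mem_triangleComplex hab hbd had, by simp⟩⟩

lemma hasTwoSkeleton_cliqueComplex {V : Type*} (G : SimpleGraph V) :
    G.cliqueComplex.HasTwoSkeleton G := by
  classical
  refine ⟨fun s hs a ha b hb => (mem_cliqueComplex_iff.mp hs).2 a ha b hb,
    fun a b d hab hbd had => ?_⟩
  have h := triple_mem_triangleComplex hab hbd had
  exact ⟨_, ⟨h.1, h.2.1⟩, by simp⟩

namespace IsCovering

variable {W V : Type*} {L : AbstractSimplicialComplex W} {G : SimpleGraph V} {p : W → V}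

lemma near_map (h : L.IsCovering G.triangleComplex p) {a b : W} (hab : L.oneSkeleton.Near a b) :
    G.Near (p a) (p b) := by
  classical
  exact near_of_mem_triangleComplex (h.simplicial _ (pair_mem_faces hab))
    (Finset.mem_image_of_mem p (by simp)) (Finset.mem_image_of_mem p (by simp))

lemma eq_of_near (h : L.IsCovering G.triangleComplex p) {w a b : W}
    (ha : L.oneSkeleton.Near w a) (hb : L.oneSkeleton.Near w b) (hab : p a = p b) : a = b := by
  classical
  have h1 : ∀ x, L.oneSkeleton.Near w x → ({x} : Finset W) ∈ L.vertexStar w := fun x hx =>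
    ⟨L.singleton_mem x, by
      have := pair_mem_faces hx
      convert this⟩
  have h2 := (h.bijOn_star w).injOn (h1 a ha) (h1 b hb) (by
    simp only [Finset.image_singleton, hab])
  simpa using h2

lemma exists_near (h : L.IsCovering G.triangleComplex p) {w : W} {y : V} (hy : G.Near (p w) y) :
    ∃ b, L.oneSkeleton.Near w b ∧ p b = y := by
  classical
  have h1 : ({y} : Finset V) ∈ G.triangleComplex.vertexStar (p w) :=
    ⟨G.triangleComplex.singleton_mem y, by
      have := triple_mem_triangleComplex hy (.refl y) hy
      rw [Finset.pair_eq_singleton] at this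
      convert this⟩
  obtain ⟨t, ⟨-, ht⟩, hty⟩ := (h.bijOn_star w).surjOn h1
  have h2 : y ∈ t.image p := by
    have h3 : t.image p = {y} := by convert hty
    simp [h3]
  obtain ⟨b, hb, rfl⟩ := Finset.mem_image.mp h2
  exact ⟨b, near_of_mem_faces ht (Finset.mem_insert_self _ _) (Finset.mem_insert_of_mem hb), rfl⟩

/-- The simplex spanned by `p w`, `p a`, `p b` lifts to the star of `w`, and local injectivity shows
that the lift contains `w`, `a` and `b`. -/
lemma exists_mem_faces (h : L.IsCovering G.triangleComplex p) {w a b : W}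
    (ha : L.oneSkeleton.Near w a) (hb : L.oneSkeleton.Near w b) (hab : G.Near (p a) (p b)) :
    ∃ t ∈ L.faces, w ∈ t ∧ a ∈ t ∧ b ∈ t := by
  classical
  have h1 := triple_mem_triangleComplex (h.near_map ha) hab (h.near_map hb)
  obtain ⟨t, ⟨ht, ht'⟩, htp⟩ := (h.bijOn_star w).surjOn
    (show ({p w, p a, p b} : Finset V) ∈ G.triangleComplex.vertexStar (p w) from
      ⟨h1, by
        have h2 : insert (p w) ({p w, p a, p b} : Finset V) = {p w, p a, p b} := by simp
        convert h1⟩)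
  have h3 : t.image p = {p w, p a, p b} := by convert htp
  have hmem : ∀ x, L.oneSkeleton.Near w x → p x ∈ ({p w, p a, p b} : Finset V) → x ∈ t := by
    intro x hx hpx
    rw [← h3] at hpx
    obtain ⟨x', hx', hxx⟩ := Finset.mem_image.mp hpx
    have h4 : L.oneSkeleton.Near w x' :=
      near_of_mem_faces ht' (Finset.mem_insert_self _ _) (Finset.mem_insert_of_mem hx')
    rwa [h.eq_of_near hx h4 hxx.symm]
  exact ⟨t, ht, hmem w .rfl (by simp), hmem a ha (by simp), hmem b hb (by simp)⟩

lemma hasTwoSkeleton (h : L.IsCovering G.triangleComplex p) : L.HasTwoSkeleton L.oneSkeleton :=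
  ⟨fun _ hs _ ha _ hb => near_of_mem_faces hs ha hb,
    fun _ _ _ hab hbd had => h.exists_mem_faces hab had (h.near_map hbd)⟩

/-- A vertex near the whole image lifts to a neighbour of one point of `Q`; lifting triangles makes
it near all of `Q`, so it belongs to `Q`. -/
lemma maximal_image (h : L.IsCovering G.triangleComplex p) {Q : Set W}
    (hQ : Maximal L.oneSkeleton.IsClique Q) (hne : Q.Nonempty) : Maximal G.IsClique (p '' Q) := by
  have hc := isClique_iff_near.mp hQ.1
  refine ⟨isClique_iff_near.mpr ?_, fun T hT hQT y hy => ?_⟩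
  · rintro _ ⟨a, ha, rfl⟩ _ ⟨b, hb, rfl⟩
    exact h.near_map (hc a ha b hb)
  · have hT' := isClique_iff_near.mp hT
    obtain ⟨a, ha⟩ := hne
    obtain ⟨b, hab, rfl⟩ := h.exists_near (hT' _ (hQT ⟨a, ha, rfl⟩) _ hy)
    refine ⟨b, mem_of_maximal_clique hQ fun x hx => ?_, rfl⟩
    obtain ⟨t, ht, -, hxt, hbt⟩ := h.exists_mem_faces (hc a ha x hx) hab
      (hT' _ (hQT ⟨x, hx, rfl⟩) _ hy)
    exact near_of_mem_faces ht hbt hxt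

/-- A common vertex of the image cliques has a lift in each clique. The lifts in `Q` and `Q₀` are
both near a point of `Q ∩ Q₀`, so they coincide. The hypothesis `hcommon` stands for either of the
two Helly properties. -/
lemma sInter_nonempty (h : L.IsCovering G.triangleComplex p) [Nonempty W] {S : Set (Set W)}
    (hS : S ⊆ L.oneSkeleton.maximalCliqueFamily) (hne : ∀ A ∈ S, ∀ B ∈ S, (A ∩ B).Nonempty)
    (hcommon : (∀ A ∈ (p '' ·) '' S, ∀ B ∈ (p '' ·) '' S, (A ∩ B).Nonempty) →
      (p '' ·) '' S ⊆ G.maximalCliqueFamily → (⋂₀ ((p '' ·) '' S)).Nonempty) :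
    (⋂₀ S).Nonempty := by
  rcases S.eq_empty_or_nonempty with rfl | ⟨Q₀, hQ₀⟩
  · simp
  obtain ⟨y, hy⟩ := hcommon (by
    rintro _ ⟨A, hA, rfl⟩ _ ⟨B, hB, rfl⟩
    obtain ⟨x, hxA, hxB⟩ := hne A hA B hB
    exact ⟨p x, ⟨x, hxA, rfl⟩, ⟨x, hxB, rfl⟩⟩) (by
    rintro _ ⟨A, hA, rfl⟩
    exact h.maximal_image (hS hA) ((hne A hA A hA).mono Set.inter_subset_left))
  obtain ⟨x, hx, rfl⟩ := hy _ ⟨Q₀, hQ₀, rfl⟩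
  refine ⟨x, fun Q hQ => ?_⟩
  obtain ⟨x', hx', hxx⟩ := hy _ ⟨Q, hQ, rfl⟩
  obtain ⟨z, hzQ, hz₀⟩ := hne Q hQ Q₀ hQ₀
  have h1 := isClique_iff_near.mp (hS hQ).1 z hzQ x' hx'
  have h2 := isClique_iff_near.mp (hS hQ₀).1 z hz₀ x hx
  rwa [← h.eq_of_near h1 h2 hxx]

lemma isCliqueHelly (h : L.IsCovering G.triangleComplex p) [Nonempty W] (hc : G.IsCliqueHelly) :
    L.oneSkeleton.IsCliqueHelly :=
  fun _ hS hne => h.sInter_nonempty hS hne fun h1 h2 => hc _ h2 h1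

lemma isFinitelyCliqueHelly (h : L.IsCovering G.triangleComplex p) [Nonempty W]
    (hc : G.IsFinitelyCliqueHelly) : L.oneSkeleton.IsFinitelyCliqueHelly :=
  fun _ hS hfin hne => h.sInter_nonempty hS hne fun h1 h2 => hc _ h2 (hfin.image _) h1

end IsCovering

end AbstractSimplicialComplex

/-! ### The main theorem -/

theorem theoremt {V : Type*} (G : SimpleGraph V) (hG : G.Connected) :
    -- the characterizations of Helly graphs
    List.TFAE
      [G.IsHelly,
       G.IsOneHelly ∧ G.IsWeaklyModular,
       G.IsCliqueHelly ∧ G.IsDismantlable,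
       G.IsCliqueHelly ∧ SimplyConnectedSpace G.cliqueComplex.Realization] ∧
    (G.cliqueComplex.IsFiniteDimensional →
      (G.IsHelly ↔ G.IsCliqueHelly ∧ ContractibleSpace G.cliqueComplex.Realization)) ∧
    (G.IsHelly ↔ G.IsCliqueHelly ∧ SimplyConnectedSpace G.triangleComplex.Realization) ∧
    -- the universal cover of the triangle complex
    (∀ (W : Type*) (L : AbstractSimplicialComplex W) (p : W → V),
      L.IsUniversalCover G.triangleComplex p →
        (G.IsCliqueHelly → L.oneSkeleton.IsHelly) ∧
        (G.IsFinitelyCliqueHelly → L.oneSkeleton.IsFinitelyHelly)) ∧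
    -- the finite version
    (G.IsFinitelyHelly →
      SimplyConnectedSpace G.triangleComplex.Realization ∧
      SimplyConnectedSpace G.cliqueComplex.Realization) ∧
    (G.IsFinitelyCliqueHelly → SimplyConnectedSpace G.triangleComplex.Realization →
      G.IsFinitelyHelly) ∧
    (G.IsFinitelyCliqueHelly → SimplyConnectedSpace G.cliqueComplex.Realization →
      G.IsFinitelyHelly) ∧
    ((∀ K : Set V, G.IsClique K → K.Finite) →
      (G.IsFinitelyHelly ↔
        G.IsFinitelyCliqueHelly ∧ SimplyConnectedSpace G.triangleComplex.Realization) ∧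
      (G.IsFinitelyHelly ↔
        G.IsFinitelyCliqueHelly ∧ SimplyConnectedSpace G.cliqueComplex.Realization)) := by
  have hT := AbstractSimplicialComplex.hasTwoSkeleton_triangleComplex G
  have hX := AbstractSimplicialComplex.hasTwoSkeleton_cliqueComplex G
  have hfinT : G.IsFinitelyCliqueHelly → SimplyConnectedSpace G.triangleComplex.Realization →
      G.IsFinitelyHelly := fun hc _ => hc.isFinitelyHelly hG hT.cocyclesTrivial
  have hfinX : G.IsFinitelyCliqueHelly → SimplyConnectedSpace G.cliqueComplex.Realization →
      G.IsFinitelyHelly := fun hc _ => hc.isFinitelyHelly hG hX.cocyclesTrivial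
  have hsc : G.IsFinitelyHelly → SimplyConnectedSpace G.triangleComplex.Realization ∧
      SimplyConnectedSpace G.cliqueComplex.Realization := fun h =>
    ⟨hT.simplyConnectedSpace hG (h.cocyclesTrivial hG),
      hX.simplyConnectedSpace hG (h.cocyclesTrivial hG)⟩
  have hX' : G.IsCliqueHelly → SimplyConnectedSpace G.cliqueComplex.Realization → G.IsHelly :=
    fun hc h => (hfinX hc.isFinitelyCliqueHelly h).isHelly hG hc
  refine ⟨?_, fun _ => ⟨fun h => ⟨h.isCliqueHelly hG, ?_⟩, fun h => hX' h.1 ?_⟩,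
    ⟨fun h => ⟨h.isCliqueHelly hG, (hsc h.isFinitelyHelly).1⟩,
      fun h => (hfinT h.1.isFinitelyCliqueHelly h.2).isHelly hG h.1⟩, ?_, hsc, hfinT, hfinX,
    fun hK => ⟨⟨fun h => ⟨h.isFinitelyCliqueHelly hG hK, (hsc h).1⟩, fun h => hfinT h.1 h.2⟩,
      ⟨fun h => ⟨h.isFinitelyCliqueHelly hG hK, (hsc h).2⟩, fun h => hfinX h.1 h.2⟩⟩⟩
  · tfae_have 1 → 2 := fun h => ⟨h.isOneHelly, SimpleGraph.isWeaklyModular_of_finitelyDominated hG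
      fun u => (h.ballDominated hG u).finitelyDominated⟩
    tfae_have 2 → 1 := fun h => h.1.isHelly hG fun u => h.2.ballDominated hG h.1 u
    tfae_have 1 → 3 := fun h => ⟨h.isCliqueHelly hG, h.isDismantlable hG⟩
    tfae_have 3 → 4 := fun h => ⟨h.1, hX.simplyConnectedSpace hG (h.2.cocyclesTrivial hG)⟩
    tfae_have 4 → 1 := fun h => hX' h.1 h.2
    tfae_finish
  · obtain ⟨u⟩ := hG.nonempty
    exact AbstractSimplicialComplex.contractibleSpace_cliqueComplex (h.ballDominated hG u) hG
  · have := h.2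
    infer_instance
  · intro W L p hL
    have := hL.simplyConnected
    have hL' := hL.isCovering.hasTwoSkeleton
    have hconn := hL'.connected
    have := hconn.nonempty
    have hfin : G.IsFinitelyCliqueHelly → L.oneSkeleton.IsFinitelyHelly := fun hc =>
      (hL.isCovering.isFinitelyCliqueHelly hc).isFinitelyHelly hconn hL'.cocyclesTrivial
    exact ⟨fun hc => (hfin hc.isFinitelyCliqueHelly).isHelly hconn
      (hL.isCovering.isCliqueHelly hc), hfin⟩
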